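/- \textbf{Short multicategories.} A \emph{short multicategory} $\mathcal C$ is a category $C$ with functors $\mathcal C_n(-;-)\colon (C^n)^{op}\times C\to\mathrm{Set}$ for $n\le 4$, where $\mathcal C_1(-;-)=C(-,-)$, and substitution functions $$\circ_i\colon \mathcal C_n(b_1,\dots,b_n;c)\times \mathcal C_m(\bar a;b_i)\to \mathcal C_{n+m-1}(b_1,\dots,b_{i-1},\bar a,b_{i+1},\dots,b_n;c),\qquad 1\le i\le n,$$ for $(n,m)=(2,2),(3,2),(2,3),(2,0),(3,0)$, natural in all variables other than $b_i$ and dinatural in $b_i$. Substitution of or into unary maps is given by the functors $\mathcal C_n$. These satisfy, for $f$ binary, $g$ of arity $n$ and $h$ of arity $p$: $f\circ_i(g\circ_j h)=(f\circ_i g)\circ_{i+j-1}h$ for $n=2$, $p\in\{2,0\}$, $i,j\in\{1,2\}$; and $(f\circ_1 g)\circ_{n+1}h=(f\circ_2 h)\circ_1 g$ for $(n,p)\in\{(2,2),(2,0),(0,2),(0,0)\}$. A \emph{morphism} is a functor $F$ together with natural families $\mathcal C_n(\bar a;b)\to\mathcal D_n(F\bar a;Fb)$ for $0\le n\le 4$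 (the functor action for $n=1$), commuting with all $\circ_i$. $\mathcal C$ is \emph{left representable} if (i) there is a nullary map $u\in\mathcal C_0(\,;i)$ such that $-\circ u\colon C(i,d)\to\mathcal C_0(\,;d)$ and $-\circ_1u\colon\mathcal C_{n+1}(i,\bar x;d)\to\mathcal C_n(\bar x;d)$, $n=1,2$, are bijections for all $\bar x,d$; and (ii) for all $a,b$ there is a binary map $\theta_{a,b}\in\mathcal C_2(a,b;ab)$ such that $-\circ_1\theta_{a,b}\colon\mathcal C_n(ab,\bar x;d)\to\mathcal C_{n+1}(a,b,\bar x;d)$, $n=1,2,3$, are bijections for all $\bar x,d$. \textbf{Braidings.} A \emph{short braiding} on $\mathcal C$ consists of natural isomorphisms $\beta^3_2\colon\mathcal C_3(a_1,a_2,a_3;b)\to\mathcal C_3(a_1,a_3,a_2;b)$, $\beta^4_2\colon\mathcal C_4(a_1,a_2,a_3,a_4;b)\to\mathcal C_4(a_1,a_3,a_2,a_4;b)$ and $\beta^4_3\colon\mathcal C_4(a_1,a_2,a_3,a_4;b)\to\mathcal C_4(a_1,a_2,a_4,a_3;b)$ such that - $\beta^4_2\beta^4_3\beta^4_2=\beta^4_3\beta^4_2\beta^4_3$;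 - $g\circ_1\beta^3_2(f)=\beta^4_2(g\circ_1f)$ and $g\circ_2\beta^3_2(f)=\beta^4_3(g\circ_2f)$ for $g$ binary and $f$ ternary; - $\beta^4_3(g\circ_1f)=\beta^3_2(g)\circ_1f$, $\beta^4_2\beta^4_3(g\circ_2f)=\beta^3_2(g)\circ_3f$ and $\beta^4_3\beta^4_2(g\circ_3f)=\beta^3_2(g)\circ_2f$ for $g$ ternary and $f$ binary. It is a \emph{short symmetry} if $\beta^3_2\beta^3_2=1$. A morphism is \emph{braided} if it commutes with $\beta^3_2,\beta^4_2,\beta^4_3$. Let $\mathrm{BrdFMulti}_{lr}$ be the category of left representable short multicategories with a short braiding and braided morphisms, and $\mathrm{SymFMulti}_{lr}$ its full subcategory on those whose braiding is a short symmetry. Let $\mathrm{BrdMon}$ be the category of braided monoidal categories and braided lax monoidal functors, and $\mathrm{SymMon}$ its full subcategory of symmetric monoidal categories. \textbf{The functor $K$.} For $\mathcal C\in\mathrm{BrdFMulti}_{lr}$, with chosen $u$ and $\theta_{a,b}$, let $K\mathcal C$ be the category $C$ with tensor product $ab$ and unit $i$; with $f\otimes g$ the map such that $(f\otimes g)\circ\theta=(\theta\circ_1f)\circ_2g$;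 with associator $\alpha$ such that $\alpha\circ(\theta_{ab,c}\circ_1\theta_{a,b})=\theta_{a,bc}\circ_2\theta_{b,c}$; with left unit isomorphism $\lambda_a\colon ia\to a$ such that $(\lambda_a\circ\theta_{i,a})\circ_1u=1_a$; and with right unit isomorphism the inverse of $\rho_a=\theta_{a,i}\circ_2u\colon a\to ai$. Let $s_{x,a,b}\colon(xa)b\to(xb)a$ be the map such that $$s_{x,a,b}\circ(\theta_{xa,b}\circ_1\theta_{x,a})=\beta^3_2(\theta_{xb,a}\circ_1\theta_{x,b}),$$ and let the braiding be $c_{a,b}=(\lambda_b\otimes 1_a)\circ s_{i,a,b}\circ(\lambda_a^{-1}\otimes 1_b)\colon ab\to ba$. This makes $K\mathcal C$ a braided monoidal category, in which $\alpha_{x,b,a}\circ s_{x,a,b}=(1_x\otimes c_{a,b})\circ\alpha_{x,a,b}$. For a braided morphism $F$, let $KF$ be the functor $F$ with the lax monoidal structure $f_0\colon i\to Fi$, $f_2\colon FaFb\to F(ab)$ such that $f_0\circ u=Fu$ and $f_2\circ\theta_{Fa,Fb}=F\theta_{a,b}$; it is a braided lax monoidal functor. \textbf{Theorem.} The functor $K$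 gives equivalences of categories $$K^{brd}\colon\mathrm{BrdFMulti}_{lr}\to\mathrm{BrdMon}\qquad\text{and}\qquad K^{sym}\colon\mathrm{SymFMulti}_{lr}\to\mathrm{SymMon}.$$ -/

import Mathlib

open CategoryTheory MonoidalCategory

set_option linter.checkUnivs false

universe v u v₁ u₁ v₂ u₂ v₃ u₃

/-- A short multicategory on the category `C` of its objects and unary multimaps (so that the set of
unary multimaps `a ⟶ b` is the hom-set of `C`).  `M₀ b`, `M₂ a₁ a₂ b`, `M₃ a₁ a₂ a₃ b` and
`M₄ a₁ a₂ a₃ a₄ b` are the sets of multimaps of arity `0`, `2`, `3` and `4`, and `actₙ` is the action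
of the functor `Mₙ(-;-) : (Cⁿ)ᵒᵖ × C ⥤ Type` on morphisms.  The operation `sub n m i` (written
`sub221` for `n = 2`, `m = 2`, `i = 1` and so on) is the substitution `g ∘ᵢ f` of an `m`-ary multimap
`f` into the `i`-th input of an `n`-ary multimap `g`.  An axiom `subnmi_nat` is naturality in all
variables other than the object along which one substitutes, and `subnmi_dinat` is dinaturality in
that object. -/
class ShortMulticategory (C : Type u) [Category.{v} C] where
  M₀ : C → Type v
  M₂ : C → C → C → Type v
  M₃ : C → C → C → C → Type v
  M₄ : C → C → C → C → C → Type v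
  -- functoriality of the sets of multimaps
  act₀ {b b' : C} (q : b ⟶ b') : M₀ b → M₀ b'
  act₂ {a₁ a₁' a₂ a₂' b b' : C} (p₁ : a₁' ⟶ a₁) (p₂ : a₂' ⟶ a₂) (q : b ⟶ b') :
    M₂ a₁ a₂ b → M₂ a₁' a₂' b'
  act₃ {a₁ a₁' a₂ a₂' a₃ a₃' b b' : C} (p₁ : a₁' ⟶ a₁) (p₂ : a₂' ⟶ a₂) (p₃ : a₃' ⟶ a₃)
    (q : b ⟶ b') : M₃ a₁ a₂ a₃ b → M₃ a₁' a₂' a₃' b'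
  act₄ {a₁ a₁' a₂ a₂' a₃ a₃' a₄ a₄' b b' : C} (p₁ : a₁' ⟶ a₁) (p₂ : a₂' ⟶ a₂) (p₃ : a₃' ⟶ a₃)
    (p₄ : a₄' ⟶ a₄) (q : b ⟶ b') : M₄ a₁ a₂ a₃ a₄ b → M₄ a₁' a₂' a₃' a₄' b'
  act₀_id {b : C} (f : M₀ b) : act₀ (𝟙 b) f = f
  act₂_id {a₁ a₂ b : C} (f : M₂ a₁ a₂ b) : act₂ (𝟙 a₁) (𝟙 a₂) (𝟙 b) f = f
  act₃_id {a₁ a₂ a₃ b : C} (f : M₃ a₁ a₂ a₃ b) : act₃ (𝟙 a₁) (𝟙 a₂) (𝟙 a₃) (𝟙 b) f = f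
  act₄_id {a₁ a₂ a₃ a₄ b : C} (f : M₄ a₁ a₂ a₃ a₄ b) :
    act₄ (𝟙 a₁) (𝟙 a₂) (𝟙 a₃) (𝟙 a₄) (𝟙 b) f = f
  act₀_comp {b b' b'' : C} (q : b ⟶ b') (q' : b' ⟶ b'') (f : M₀ b) :
    act₀ q' (act₀ q f) = act₀ (q ≫ q') f
  act₂_comp {a₁ a₁' a₁'' a₂ a₂' a₂'' b b' b'' : C} (p₁ : a₁' ⟶ a₁) (p₁' : a₁'' ⟶ a₁')
    (p₂ : a₂' ⟶ a₂) (p₂' : a₂'' ⟶ a₂') (q : b ⟶ b') (q' : b' ⟶ b'') (f : M₂ a₁ a₂ b) :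
    act₂ p₁' p₂' q' (act₂ p₁ p₂ q f) = act₂ (p₁' ≫ p₁) (p₂' ≫ p₂) (q ≫ q') f
  act₃_comp {a₁ a₁' a₁'' a₂ a₂' a₂'' a₃ a₃' a₃'' b b' b'' : C} (p₁ : a₁' ⟶ a₁)
    (p₁' : a₁'' ⟶ a₁') (p₂ : a₂' ⟶ a₂) (p₂' : a₂'' ⟶ a₂') (p₃ : a₃' ⟶ a₃) (p₃' : a₃'' ⟶ a₃')
    (q : b ⟶ b') (q' : b' ⟶ b'') (f : M₃ a₁ a₂ a₃ b) :
    act₃ p₁' p₂' p₃' q' (act₃ p₁ p₂ p₃ q f) =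
      act₃ (p₁' ≫ p₁) (p₂' ≫ p₂) (p₃' ≫ p₃) (q ≫ q') f
  act₄_comp {a₁ a₁' a₁'' a₂ a₂' a₂'' a₃ a₃' a₃'' a₄ a₄' a₄'' b b' b'' : C} (p₁ : a₁' ⟶ a₁)
    (p₁' : a₁'' ⟶ a₁') (p₂ : a₂' ⟶ a₂) (p₂' : a₂'' ⟶ a₂') (p₃ : a₃' ⟶ a₃) (p₃' : a₃'' ⟶ a₃')
    (p₄ : a₄' ⟶ a₄) (p₄' : a₄'' ⟶ a₄') (q : b ⟶ b') (q' : b' ⟶ b'') (f : M₄ a₁ a₂ a₃ a₄ b) :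
    act₄ p₁' p₂' p₃' p₄' q' (act₄ p₁ p₂ p₃ p₄ q f) =
      act₄ (p₁' ≫ p₁) (p₂' ≫ p₂) (p₃' ≫ p₃) (p₄' ≫ p₄) (q ≫ q') f
  -- substitution of binary into binary
  sub221 {a₁ a₂ b₁ b₂ c : C} : M₂ b₁ b₂ c → M₂ a₁ a₂ b₁ → M₃ a₁ a₂ b₂ c
  sub222 {a₁ a₂ b₁ b₂ c : C} : M₂ b₁ b₂ c → M₂ a₁ a₂ b₂ → M₃ b₁ a₁ a₂ c
  -- substitution of binary into ternary
  sub321 {a₁ a₂ b₁ b₂ b₃ c : C} : M₃ b₁ b₂ b₃ c → M₂ a₁ a₂ b₁ → M₄ a₁ a₂ b₂ b₃ c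
  sub322 {a₁ a₂ b₁ b₂ b₃ c : C} : M₃ b₁ b₂ b₃ c → M₂ a₁ a₂ b₂ → M₄ b₁ a₁ a₂ b₃ c
  sub323 {a₁ a₂ b₁ b₂ b₃ c : C} : M₃ b₁ b₂ b₃ c → M₂ a₁ a₂ b₃ → M₄ b₁ b₂ a₁ a₂ c
  -- substitution of ternary into binary
  sub231 {a₁ a₂ a₃ b₁ b₂ c : C} : M₂ b₁ b₂ c → M₃ a₁ a₂ a₃ b₁ → M₄ a₁ a₂ a₃ b₂ c
  sub232 {a₁ a₂ a₃ b₁ b₂ c : C} : M₂ b₁ b₂ c → M₃ a₁ a₂ a₃ b₂ → M₄ b₁ a₁ a₂ a₃ c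
  -- substitution of nullary into binary
  sub201 {b₁ b₂ c : C} : M₂ b₁ b₂ c → M₀ b₁ → (b₂ ⟶ c)
  sub202 {b₁ b₂ c : C} : M₂ b₁ b₂ c → M₀ b₂ → (b₁ ⟶ c)
  -- substitution of nullary into ternary
  sub301 {b₁ b₂ b₃ c : C} : M₃ b₁ b₂ b₃ c → M₀ b₁ → M₂ b₂ b₃ c
  sub302 {b₁ b₂ b₃ c : C} : M₃ b₁ b₂ b₃ c → M₀ b₂ → M₂ b₁ b₃ c
  sub303 {b₁ b₂ b₃ c : C} : M₃ b₁ b₂ b₃ c → M₀ b₃ → M₂ b₁ b₂ c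
  -- naturality and dinaturality of the substitutions
  sub221_nat {a₁ a₁' a₂ a₂' b₁ b₂ b₂' c c' : C} (p₁ : a₁' ⟶ a₁) (p₂ : a₂' ⟶ a₂) (r₂ : b₂' ⟶ b₂)
    (q : c ⟶ c') (g : M₂ b₁ b₂ c) (f : M₂ a₁ a₂ b₁) :
    act₃ p₁ p₂ r₂ q (sub221 g f) = sub221 (act₂ (𝟙 b₁) r₂ q g) (act₂ p₁ p₂ (𝟙 b₁) f)
  sub221_dinat {a₁ a₂ b₁ b₁' b₂ c : C} (h : b₁ ⟶ b₁') (g : M₂ b₁' b₂ c) (f : M₂ a₁ a₂ b₁) :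
    sub221 (act₂ h (𝟙 b₂) (𝟙 c) g) f = sub221 g (act₂ (𝟙 a₁) (𝟙 a₂) h f)
  sub222_nat {a₁ a₁' a₂ a₂' b₁ b₁' b₂ c c' : C} (p₁ : a₁' ⟶ a₁) (p₂ : a₂' ⟶ a₂) (r₁ : b₁' ⟶ b₁)
    (q : c ⟶ c') (g : M₂ b₁ b₂ c) (f : M₂ a₁ a₂ b₂) :
    act₃ r₁ p₁ p₂ q (sub222 g f) = sub222 (act₂ r₁ (𝟙 b₂) q g) (act₂ p₁ p₂ (𝟙 b₂) f)
  sub222_dinat {a₁ a₂ b₁ b₂ b₂' c : C} (h : b₂ ⟶ b₂') (g : M₂ b₁ b₂' c) (f : M₂ a₁ a₂ b₂) :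
    sub222 (act₂ (𝟙 b₁) h (𝟙 c) g) f = sub222 g (act₂ (𝟙 a₁) (𝟙 a₂) h f)
  sub321_nat {a₁ a₁' a₂ a₂' b₁ b₂ b₂' b₃ b₃' c c' : C} (p₁ : a₁' ⟶ a₁) (p₂ : a₂' ⟶ a₂)
    (r₂ : b₂' ⟶ b₂) (r₃ : b₃' ⟶ b₃) (q : c ⟶ c') (g : M₃ b₁ b₂ b₃ c) (f : M₂ a₁ a₂ b₁) :
    act₄ p₁ p₂ r₂ r₃ q (sub321 g f) = sub321 (act₃ (𝟙 b₁) r₂ r₃ q g) (act₂ p₁ p₂ (𝟙 b₁) f)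
  sub321_dinat {a₁ a₂ b₁ b₁' b₂ b₃ c : C} (h : b₁ ⟶ b₁') (g : M₃ b₁' b₂ b₃ c) (f : M₂ a₁ a₂ b₁) :
    sub321 (act₃ h (𝟙 b₂) (𝟙 b₃) (𝟙 c) g) f = sub321 g (act₂ (𝟙 a₁) (𝟙 a₂) h f)
  sub322_nat {a₁ a₁' a₂ a₂' b₁ b₁' b₂ b₃ b₃' c c' : C} (p₁ : a₁' ⟶ a₁) (p₂ : a₂' ⟶ a₂)
    (r₁ : b₁' ⟶ b₁) (r₃ : b₃' ⟶ b₃) (q : c ⟶ c') (g : M₃ b₁ b₂ b₃ c) (f : M₂ a₁ a₂ b₂) :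
    act₄ r₁ p₁ p₂ r₃ q (sub322 g f) = sub322 (act₃ r₁ (𝟙 b₂) r₃ q g) (act₂ p₁ p₂ (𝟙 b₂) f)
  sub322_dinat {a₁ a₂ b₁ b₂ b₂' b₃ c : C} (h : b₂ ⟶ b₂') (g : M₃ b₁ b₂' b₃ c) (f : M₂ a₁ a₂ b₂) :
    sub322 (act₃ (𝟙 b₁) h (𝟙 b₃) (𝟙 c) g) f = sub322 g (act₂ (𝟙 a₁) (𝟙 a₂) h f)
  sub323_nat {a₁ a₁' a₂ a₂' b₁ b₁' b₂ b₂' b₃ c c' : C} (p₁ : a₁' ⟶ a₁) (p₂ : a₂' ⟶ a₂)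
    (r₁ : b₁' ⟶ b₁) (r₂ : b₂' ⟶ b₂) (q : c ⟶ c') (g : M₃ b₁ b₂ b₃ c) (f : M₂ a₁ a₂ b₃) :
    act₄ r₁ r₂ p₁ p₂ q (sub323 g f) = sub323 (act₃ r₁ r₂ (𝟙 b₃) q g) (act₂ p₁ p₂ (𝟙 b₃) f)
  sub323_dinat {a₁ a₂ b₁ b₂ b₃ b₃' c : C} (h : b₃ ⟶ b₃') (g : M₃ b₁ b₂ b₃' c) (f : M₂ a₁ a₂ b₃) :
    sub323 (act₃ (𝟙 b₁) (𝟙 b₂) h (𝟙 c) g) f = sub323 g (act₂ (𝟙 a₁) (𝟙 a₂) h f)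
  sub231_nat {a₁ a₁' a₂ a₂' a₃ a₃' b₁ b₂ b₂' c c' : C} (p₁ : a₁' ⟶ a₁) (p₂ : a₂' ⟶ a₂)
    (p₃ : a₃' ⟶ a₃) (r₂ : b₂' ⟶ b₂) (q : c ⟶ c') (g : M₂ b₁ b₂ c) (f : M₃ a₁ a₂ a₃ b₁) :
    act₄ p₁ p₂ p₃ r₂ q (sub231 g f) = sub231 (act₂ (𝟙 b₁) r₂ q g) (act₃ p₁ p₂ p₃ (𝟙 b₁) f)
  sub231_dinat {a₁ a₂ a₃ b₁ b₁' b₂ c : C} (h : b₁ ⟶ b₁') (g : M₂ b₁' b₂ c) (f : M₃ a₁ a₂ a₃ b₁) :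
    sub231 (act₂ h (𝟙 b₂) (𝟙 c) g) f = sub231 g (act₃ (𝟙 a₁) (𝟙 a₂) (𝟙 a₃) h f)
  sub232_nat {a₁ a₁' a₂ a₂' a₃ a₃' b₁ b₁' b₂ c c' : C} (p₁ : a₁' ⟶ a₁) (p₂ : a₂' ⟶ a₂)
    (p₃ : a₃' ⟶ a₃) (r₁ : b₁' ⟶ b₁) (q : c ⟶ c') (g : M₂ b₁ b₂ c) (f : M₃ a₁ a₂ a₃ b₂) :
    act₄ r₁ p₁ p₂ p₃ q (sub232 g f) = sub232 (act₂ r₁ (𝟙 b₂) q g) (act₃ p₁ p₂ p₃ (𝟙 b₂) f)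
  sub232_dinat {a₁ a₂ a₃ b₁ b₂ b₂' c : C} (h : b₂ ⟶ b₂') (g : M₂ b₁ b₂' c) (f : M₃ a₁ a₂ a₃ b₂) :
    sub232 (act₂ (𝟙 b₁) h (𝟙 c) g) f = sub232 g (act₃ (𝟙 a₁) (𝟙 a₂) (𝟙 a₃) h f)
  sub201_nat {b₁ b₂ b₂' c c' : C} (r₂ : b₂' ⟶ b₂) (q : c ⟶ c') (g : M₂ b₁ b₂ c) (f : M₀ b₁) :
    r₂ ≫ sub201 g f ≫ q = sub201 (act₂ (𝟙 b₁) r₂ q g) f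
  sub201_dinat {b₁ b₁' b₂ c : C} (h : b₁ ⟶ b₁') (g : M₂ b₁' b₂ c) (f : M₀ b₁) :
    sub201 (act₂ h (𝟙 b₂) (𝟙 c) g) f = sub201 g (act₀ h f)
  sub202_nat {b₁ b₁' b₂ c c' : C} (r₁ : b₁' ⟶ b₁) (q : c ⟶ c') (g : M₂ b₁ b₂ c) (f : M₀ b₂) :
    r₁ ≫ sub202 g f ≫ q = sub202 (act₂ r₁ (𝟙 b₂) q g) f
  sub202_dinat {b₁ b₂ b₂' c : C} (h : b₂ ⟶ b₂') (g : M₂ b₁ b₂' c) (f : M₀ b₂) :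
    sub202 (act₂ (𝟙 b₁) h (𝟙 c) g) f = sub202 g (act₀ h f)
  sub301_nat {b₁ b₂ b₂' b₃ b₃' c c' : C} (r₂ : b₂' ⟶ b₂) (r₃ : b₃' ⟶ b₃) (q : c ⟶ c')
    (g : M₃ b₁ b₂ b₃ c) (f : M₀ b₁) :
    act₂ r₂ r₃ q (sub301 g f) = sub301 (act₃ (𝟙 b₁) r₂ r₃ q g) f
  sub301_dinat {b₁ b₁' b₂ b₃ c : C} (h : b₁ ⟶ b₁') (g : M₃ b₁' b₂ b₃ c) (f : M₀ b₁) :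
    sub301 (act₃ h (𝟙 b₂) (𝟙 b₃) (𝟙 c) g) f = sub301 g (act₀ h f)
  sub302_nat {b₁ b₁' b₂ b₃ b₃' c c' : C} (r₁ : b₁' ⟶ b₁) (r₃ : b₃' ⟶ b₃) (q : c ⟶ c')
    (g : M₃ b₁ b₂ b₃ c) (f : M₀ b₂) :
    act₂ r₁ r₃ q (sub302 g f) = sub302 (act₃ r₁ (𝟙 b₂) r₃ q g) f
  sub302_dinat {b₁ b₂ b₂' b₃ c : C} (h : b₂ ⟶ b₂') (g : M₃ b₁ b₂' b₃ c) (f : M₀ b₂) :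
    sub302 (act₃ (𝟙 b₁) h (𝟙 b₃) (𝟙 c) g) f = sub302 g (act₀ h f)
  sub303_nat {b₁ b₁' b₂ b₂' b₃ c c' : C} (r₁ : b₁' ⟶ b₁) (r₂ : b₂' ⟶ b₂) (q : c ⟶ c')
    (g : M₃ b₁ b₂ b₃ c) (f : M₀ b₃) :
    act₂ r₁ r₂ q (sub303 g f) = sub303 (act₃ r₁ r₂ (𝟙 b₃) q g) f
  sub303_dinat {b₁ b₂ b₃ b₃' c : C} (h : b₃ ⟶ b₃') (g : M₃ b₁ b₂ b₃' c) (f : M₀ b₃) :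
    sub303 (act₃ (𝟙 b₁) (𝟙 b₂) h (𝟙 c) g) f = sub303 g (act₀ h f)
  -- `f ∘ᵢ (g ∘ⱼ h) = (f ∘ᵢ g) ∘ᵢ₊ⱼ₋₁ h` with `f`, `g`, `h` binary
  assoc2_11 {a a' b c d x y : C} (f : M₂ c d y) (g : M₂ x b c) (h : M₂ a a' x) :
    sub231 f (sub221 g h) = sub321 (sub221 f g) h
  assoc2_12 {a a' b c d x y : C} (f : M₂ c d y) (g : M₂ b x c) (h : M₂ a a' x) :
    sub231 f (sub222 g h) = sub322 (sub221 f g) h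
  assoc2_21 {a a' b c d x y : C} (f : M₂ d c y) (g : M₂ x b c) (h : M₂ a a' x) :
    sub232 f (sub221 g h) = sub322 (sub222 f g) h
  assoc2_22 {a a' b c d x y : C} (f : M₂ d c y) (g : M₂ b x c) (h : M₂ a a' x) :
    sub232 f (sub222 g h) = sub323 (sub222 f g) h
  -- the same equations with `f`, `g` binary and `h` nullary
  assoc0_11 {b c d x y : C} (f : M₂ c d y) (g : M₂ x b c) (h : M₀ x) :
    act₂ (sub201 g h) (𝟙 d) (𝟙 y) f = sub301 (sub221 f g) h
  assoc0_12 {b c d x y : C} (f : M₂ c d y) (g : M₂ b x c) (h : M₀ x) :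
    act₂ (sub202 g h) (𝟙 d) (𝟙 y) f = sub302 (sub221 f g) h
  assoc0_21 {b c d x y : C} (f : M₂ d c y) (g : M₂ x b c) (h : M₀ x) :
    act₂ (𝟙 d) (sub201 g h) (𝟙 y) f = sub302 (sub222 f g) h
  assoc0_22 {b c d x y : C} (f : M₂ d c y) (g : M₂ b x c) (h : M₀ x) :
    act₂ (𝟙 d) (sub202 g h) (𝟙 y) f = sub303 (sub222 f g) h
  -- `(f ∘₁ g) ∘ₙ₊₁ h = (f ∘₂ h) ∘₁ g` with `f` binary, `g` of arity `n` and `h` of arity `p`,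
  -- for `(n, p) = (2, 2), (2, 0), (0, 2), (0, 0)`
  comm_22 {a₁ a₂ a₃ a₄ b₁ b₂ c : C} (f : M₂ b₁ b₂ c) (g : M₂ a₁ a₂ b₁) (h : M₂ a₃ a₄ b₂) :
    sub323 (sub221 f g) h = sub321 (sub222 f h) g
  comm_20 {a₁ a₂ b₁ b₂ c : C} (f : M₂ b₁ b₂ c) (g : M₂ a₁ a₂ b₁) (h : M₀ b₂) :
    sub303 (sub221 f g) h = act₂ (𝟙 a₁) (𝟙 a₂) (sub202 f h) g
  comm_02 {a₃ a₄ b₁ b₂ c : C} (f : M₂ b₁ b₂ c) (g : M₀ b₁) (h : M₂ a₃ a₄ b₂) :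
    act₂ (𝟙 a₃) (𝟙 a₄) (sub201 f g) h = sub301 (sub222 f h) g
  comm_00 {b₁ b₂ c : C} (f : M₂ b₁ b₂ c) (g : M₀ b₁) (h : M₀ b₂) :
    act₀ (sub201 f g) h = act₀ (sub202 f h) g

namespace ShortMulticategory

/-- `u : M₀ i` is a left universal nullary map classifier. -/
structure IsLeftUniversalNullary {C : Type u} [Category.{v} C] [ShortMulticategory C] {i : C}
    (u : M₀ i) : Prop where
  bijective₀ (b : C) : Function.Bijective fun f : i ⟶ b ↦ act₀ f u
  bijective₁ (x d : C) : Function.Bijective fun f : M₂ i x d ↦ sub201 f u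
  bijective₂ (x y d : C) : Function.Bijective fun f : M₃ i x y d ↦ sub301 f u

/-- `θ : M₂ a b m` is a left universal binary map classifier for `a`, `b`. -/
structure IsLeftUniversalBinary {C : Type u} [Category.{v} C] [ShortMulticategory C] {a b m : C}
    (θ : M₂ a b m) : Prop where
  bijective₂ (d : C) : Function.Bijective fun f : m ⟶ d ↦ act₂ (𝟙 a) (𝟙 b) f θ
  bijective₃ (x d : C) : Function.Bijective fun f : M₂ m x d ↦ sub221 f θ
  bijective₄ (x y d : C) : Function.Bijective fun f : M₃ m x y d ↦ sub321 f θ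

/-- A short multicategory is left representable if it admits left universal nullary and binary map
classifiers. -/
class LeftRepresentable (C : Type u) [Category.{v} C] [ShortMulticategory C] : Prop where
  nullary : ∃ (i : C) (u : M₀ i), IsLeftUniversalNullary u
  binary (a b : C) : ∃ (m : C) (θ : M₂ a b m), IsLeftUniversalBinary θ

/-- A short braiding on a short multicategory. -/
class ShortBraiding (C : Type u) [Category.{v} C] [ShortMulticategory C] where
  β₃₂ {a₁ a₂ a₃ b : C} : M₃ a₁ a₂ a₃ b ≃ M₃ a₁ a₃ a₂ b
  β₄₂ {a₁ a₂ a₃ a₄ b : C} : M₄ a₁ a₂ a₃ a₄ b ≃ M₄ a₁ a₃ a₂ a₄ b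
  β₄₃ {a₁ a₂ a₃ a₄ b : C} : M₄ a₁ a₂ a₃ a₄ b ≃ M₄ a₁ a₂ a₄ a₃ b
  β₃₂_nat {a₁ a₁' a₂ a₂' a₃ a₃' b b' : C} (p₁ : a₁' ⟶ a₁) (p₂ : a₂' ⟶ a₂) (p₃ : a₃' ⟶ a₃)
    (q : b ⟶ b') (f : M₃ a₁ a₂ a₃ b) : β₃₂ (act₃ p₁ p₂ p₃ q f) = act₃ p₁ p₃ p₂ q (β₃₂ f)
  β₄₂_nat {a₁ a₁' a₂ a₂' a₃ a₃' a₄ a₄' b b' : C} (p₁ : a₁' ⟶ a₁) (p₂ : a₂' ⟶ a₂)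
    (p₃ : a₃' ⟶ a₃) (p₄ : a₄' ⟶ a₄) (q : b ⟶ b') (f : M₄ a₁ a₂ a₃ a₄ b) :
    β₄₂ (act₄ p₁ p₂ p₃ p₄ q f) = act₄ p₁ p₃ p₂ p₄ q (β₄₂ f)
  β₄₃_nat {a₁ a₁' a₂ a₂' a₃ a₃' a₄ a₄' b b' : C} (p₁ : a₁' ⟶ a₁) (p₂ : a₂' ⟶ a₂)
    (p₃ : a₃' ⟶ a₃) (p₄ : a₄' ⟶ a₄) (q : b ⟶ b') (f : M₄ a₁ a₂ a₃ a₄ b) :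
    β₄₃ (act₄ p₁ p₂ p₃ p₄ q f) = act₄ p₁ p₂ p₄ p₃ q (β₄₃ f)
  yang_baxter {a₁ a₂ a₃ a₄ b : C} (h : M₄ a₁ a₂ a₃ a₄ b) :
    β₄₂ (β₄₃ (β₄₂ h)) = β₄₃ (β₄₂ (β₄₃ h))
  sub231_β₃₂ {a₁ a₂ a₃ b₁ b₂ c : C} (g : M₂ b₁ b₂ c) (f : M₃ a₁ a₂ a₃ b₁) :
    sub231 g (β₃₂ f) = β₄₂ (sub231 g f)
  sub232_β₃₂ {a₁ a₂ a₃ b₁ b₂ c : C} (g : M₂ b₁ b₂ c) (f : M₃ a₁ a₂ a₃ b₂) :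
    sub232 g (β₃₂ f) = β₄₃ (sub232 g f)
  β₄₃_sub321 {a₁ a₂ b₁ b₂ b₃ c : C} (g : M₃ b₁ b₂ b₃ c) (f : M₂ a₁ a₂ b₁) :
    β₄₃ (sub321 g f) = sub321 (β₃₂ g) f
  β₄₂_β₄₃_sub322 {a₁ a₂ b₁ b₂ b₃ c : C} (g : M₃ b₁ b₂ b₃ c) (f : M₂ a₁ a₂ b₂) :
    β₄₂ (β₄₃ (sub322 g f)) = sub323 (β₃₂ g) f
  β₄₃_β₄₂_sub323 {a₁ a₂ b₁ b₂ b₃ c : C} (g : M₃ b₁ b₂ b₃ c) (f : M₂ a₁ a₂ b₃) :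
    β₄₃ (β₄₂ (sub323 g f)) = sub322 (β₃₂ g) f

open ShortBraiding

/-- A short braiding is a short symmetry if `β₃₂` is its own inverse. -/
def IsShortSymmetry (C : Type u) [Category.{v} C] [ShortMulticategory C] [ShortBraiding C] : Prop :=
  ∀ {a₁ a₂ a₃ b : C} (f : M₃ a₁ a₂ a₃ b), β₃₂ (β₃₂ f) = f

end ShortMulticategory

open ShortMulticategory ShortMulticategory.ShortBraiding

/-- A morphism of short multicategories: a functor together with natural families of maps on the
multimaps of arity `0`, `2`, `3`, `4`, commuting with all the substitution operations. -/
structure ShortMultifunctor (C : Type u₁) [Category.{v₁} C] [ShortMulticategory C]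
    (D : Type u₂) [Category.{v₂} D] [ShortMulticategory D] extends C ⥤ D where
  map₀ {b : C} : M₀ b → M₀ (obj b)
  map₂ {a₁ a₂ b : C} : M₂ a₁ a₂ b → M₂ (obj a₁) (obj a₂) (obj b)
  map₃ {a₁ a₂ a₃ b : C} : M₃ a₁ a₂ a₃ b → M₃ (obj a₁) (obj a₂) (obj a₃) (obj b)
  map₄ {a₁ a₂ a₃ a₄ b : C} : M₄ a₁ a₂ a₃ a₄ b → M₄ (obj a₁) (obj a₂) (obj a₃) (obj a₄) (obj b)
  map₀_act {b b' : C} (q : b ⟶ b') (f : M₀ b) : map₀ (act₀ q f) = act₀ (map q) (map₀ f)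
  map₂_act {a₁ a₁' a₂ a₂' b b' : C} (p₁ : a₁' ⟶ a₁) (p₂ : a₂' ⟶ a₂) (q : b ⟶ b')
    (f : M₂ a₁ a₂ b) : map₂ (act₂ p₁ p₂ q f) = act₂ (map p₁) (map p₂) (map q) (map₂ f)
  map₃_act {a₁ a₁' a₂ a₂' a₃ a₃' b b' : C} (p₁ : a₁' ⟶ a₁) (p₂ : a₂' ⟶ a₂) (p₃ : a₃' ⟶ a₃)
    (q : b ⟶ b') (f : M₃ a₁ a₂ a₃ b) :
    map₃ (act₃ p₁ p₂ p₃ q f) = act₃ (map p₁) (map p₂) (map p₃) (map q) (map₃ f)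
  map₄_act {a₁ a₁' a₂ a₂' a₃ a₃' a₄ a₄' b b' : C} (p₁ : a₁' ⟶ a₁) (p₂ : a₂' ⟶ a₂)
    (p₃ : a₃' ⟶ a₃) (p₄ : a₄' ⟶ a₄) (q : b ⟶ b') (f : M₄ a₁ a₂ a₃ a₄ b) :
    map₄ (act₄ p₁ p₂ p₃ p₄ q f) = act₄ (map p₁) (map p₂) (map p₃) (map p₄) (map q) (map₄ f)
  map_sub221 {a₁ a₂ b₁ b₂ c : C} (g : M₂ b₁ b₂ c) (f : M₂ a₁ a₂ b₁) :
    map₃ (sub221 g f) = sub221 (map₂ g) (map₂ f)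
  map_sub222 {a₁ a₂ b₁ b₂ c : C} (g : M₂ b₁ b₂ c) (f : M₂ a₁ a₂ b₂) :
    map₃ (sub222 g f) = sub222 (map₂ g) (map₂ f)
  map_sub321 {a₁ a₂ b₁ b₂ b₃ c : C} (g : M₃ b₁ b₂ b₃ c) (f : M₂ a₁ a₂ b₁) :
    map₄ (sub321 g f) = sub321 (map₃ g) (map₂ f)
  map_sub322 {a₁ a₂ b₁ b₂ b₃ c : C} (g : M₃ b₁ b₂ b₃ c) (f : M₂ a₁ a₂ b₂) :
    map₄ (sub322 g f) = sub322 (map₃ g) (map₂ f)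
  map_sub323 {a₁ a₂ b₁ b₂ b₃ c : C} (g : M₃ b₁ b₂ b₃ c) (f : M₂ a₁ a₂ b₃) :
    map₄ (sub323 g f) = sub323 (map₃ g) (map₂ f)
  map_sub231 {a₁ a₂ a₃ b₁ b₂ c : C} (g : M₂ b₁ b₂ c) (f : M₃ a₁ a₂ a₃ b₁) :
    map₄ (sub231 g f) = sub231 (map₂ g) (map₃ f)
  map_sub232 {a₁ a₂ a₃ b₁ b₂ c : C} (g : M₂ b₁ b₂ c) (f : M₃ a₁ a₂ a₃ b₂) :
    map₄ (sub232 g f) = sub232 (map₂ g) (map₃ f)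
  map_sub201 {b₁ b₂ c : C} (g : M₂ b₁ b₂ c) (f : M₀ b₁) :
    map (sub201 g f) = sub201 (map₂ g) (map₀ f)
  map_sub202 {b₁ b₂ c : C} (g : M₂ b₁ b₂ c) (f : M₀ b₂) :
    map (sub202 g f) = sub202 (map₂ g) (map₀ f)
  map_sub301 {b₁ b₂ b₃ c : C} (g : M₃ b₁ b₂ b₃ c) (f : M₀ b₁) :
    map₂ (sub301 g f) = sub301 (map₃ g) (map₀ f)
  map_sub302 {b₁ b₂ b₃ c : C} (g : M₃ b₁ b₂ b₃ c) (f : M₀ b₂) :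
    map₂ (sub302 g f) = sub302 (map₃ g) (map₀ f)
  map_sub303 {b₁ b₂ b₃ c : C} (g : M₃ b₁ b₂ b₃ c) (f : M₀ b₃) :
    map₂ (sub303 g f) = sub303 (map₃ g) (map₀ f)

namespace ShortMultifunctor

/-- The identity morphism of short multicategories. -/
def id (C : Type u₁) [Category.{v₁} C] [ShortMulticategory C] : ShortMultifunctor C C where
  toFunctor := 𝟭 C
  map₀ f := f
  map₂ f := f
  map₃ f := f
  map₄ f := f
  map₀_act _ _ := rfl
  map₂_act _ _ _ _ := rfl
  map₃_act _ _ _ _ _ := rfl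
  map₄_act _ _ _ _ _ _ := rfl
  map_sub221 _ _ := rfl
  map_sub222 _ _ := rfl
  map_sub321 _ _ := rfl
  map_sub322 _ _ := rfl
  map_sub323 _ _ := rfl
  map_sub231 _ _ := rfl
  map_sub232 _ _ := rfl
  map_sub201 _ _ := rfl
  map_sub202 _ _ := rfl
  map_sub301 _ _ := rfl
  map_sub302 _ _ := rfl
  map_sub303 _ _ := rfl

/-- Composition of morphisms of short multicategories. -/
def comp {C : Type u₁} [Category.{v₁} C] [ShortMulticategory C]
    {D : Type u₂} [Category.{v₂} D] [ShortMulticategory D]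
    {E : Type u₃} [Category.{v₃} E] [ShortMulticategory E]
    (F : ShortMultifunctor C D) (G : ShortMultifunctor D E) : ShortMultifunctor C E where
  toFunctor := F.toFunctor ⋙ G.toFunctor
  map₀ f := G.map₀ (F.map₀ f)
  map₂ f := G.map₂ (F.map₂ f)
  map₃ f := G.map₃ (F.map₃ f)
  map₄ f := G.map₄ (F.map₄ f)
  map₀_act _ _ := by simp [F.map₀_act, G.map₀_act]
  map₂_act _ _ _ _ := by simp [F.map₂_act, G.map₂_act]
  map₃_act _ _ _ _ _ := by simp [F.map₃_act, G.map₃_act]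
  map₄_act _ _ _ _ _ _ := by simp [F.map₄_act, G.map₄_act]
  map_sub221 _ _ := by simp [F.map_sub221, G.map_sub221]
  map_sub222 _ _ := by simp [F.map_sub222, G.map_sub222]
  map_sub321 _ _ := by simp [F.map_sub321, G.map_sub321]
  map_sub322 _ _ := by simp [F.map_sub322, G.map_sub322]
  map_sub323 _ _ := by simp [F.map_sub323, G.map_sub323]
  map_sub231 _ _ := by simp [F.map_sub231, G.map_sub231]
  map_sub232 _ _ := by simp [F.map_sub232, G.map_sub232]
  map_sub201 _ _ := by simp [F.map_sub201, G.map_sub201]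
  map_sub202 _ _ := by simp [F.map_sub202, G.map_sub202]
  map_sub301 _ _ := by simp [F.map_sub301, G.map_sub301]
  map_sub302 _ _ := by simp [F.map_sub302, G.map_sub302]
  map_sub303 _ _ := by simp [F.map_sub303, G.map_sub303]

/-- A morphism between braided short multicategories is braided if it respects `β₃₂`, `β₄₂` and
`β₄₃`. -/
structure IsBraided {C : Type u₁} [Category.{v₁} C] [ShortMulticategory C] [ShortBraiding C]
    {D : Type u₂} [Category.{v₂} D] [ShortMulticategory D] [ShortBraiding D]
    (F : ShortMultifunctor C D) : Prop where
  map_β₃₂ {a₁ a₂ a₃ b : C} (f : M₃ a₁ a₂ a₃ b) : F.map₃ (β₃₂ f) = β₃₂ (F.map₃ f)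
  map_β₄₂ {a₁ a₂ a₃ a₄ b : C} (f : M₄ a₁ a₂ a₃ a₄ b) : F.map₄ (β₄₂ f) = β₄₂ (F.map₄ f)
  map_β₄₃ {a₁ a₂ a₃ a₄ b : C} (f : M₄ a₁ a₂ a₃ a₄ b) : F.map₄ (β₄₃ f) = β₄₃ (F.map₄ f)

end ShortMultifunctor

/-- A (left) skew monoidal category, with tensor product `ten`, unit `one`, and structure maps
`al : (ab)c ⟶ a(bc)`, `lam : ia ⟶ a`, `rh : a ⟶ ai`. -/
class SkewMonoidal (C : Type u) [Category.{v} C] where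
  ten : C → C → C
  tenHom {a a' b b' : C} (f : a ⟶ a') (g : b ⟶ b') : ten a b ⟶ ten a' b'
  one : C
  al (a b c : C) : ten (ten a b) c ⟶ ten a (ten b c)
  lam (a : C) : ten one a ⟶ a
  rh (a : C) : a ⟶ ten a one
  tenHom_id (a b : C) : tenHom (𝟙 a) (𝟙 b) = 𝟙 (ten a b)
  tenHom_comp {a a' a'' b b' b'' : C} (f : a ⟶ a') (f' : a' ⟶ a'') (g : b ⟶ b') (g' : b' ⟶ b'') :
    tenHom f g ≫ tenHom f' g' = tenHom (f ≫ f') (g ≫ g')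
  al_nat {a a' b b' c c' : C} (f : a ⟶ a') (g : b ⟶ b') (h : c ⟶ c') :
    tenHom (tenHom f g) h ≫ al a' b' c' = al a b c ≫ tenHom f (tenHom g h)
  lam_nat {a a' : C} (f : a ⟶ a') : tenHom (𝟙 one) f ≫ lam a' = lam a ≫ f
  rh_nat {a a' : C} (f : a ⟶ a') : f ≫ rh a' = rh a ≫ tenHom f (𝟙 one)
  abcd (a b c d : C) : tenHom (al a b c) (𝟙 d) ≫ al a (ten b c) d ≫ tenHom (𝟙 a) (al b c d) =
    al (ten a b) c d ≫ al a b (ten c d)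
  iab (a b : C) : al one a b ≫ lam (ten a b) = tenHom (lam a) (𝟙 b)
  abi (a b : C) : rh (ten a b) ≫ al a b one = tenHom (𝟙 a) (rh b)
  aib (a b : C) : tenHom (rh a) (𝟙 b) ≫ al a one b ≫ tenHom (𝟙 a) (lam b) = 𝟙 (ten a b)
  ii : rh one ≫ lam one = 𝟙 one

namespace SkewMonoidal

/-- A skew monoidal category is left normal if its left unit maps are invertible. -/
class LeftNormal (C : Type u) [Category.{v} C] [SkewMonoidal C] : Prop where
  isIso_lam (a : C) : IsIso (lam a)

attribute [instance] LeftNormal.isIso_lam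

/-- A braiding on a skew monoidal category, with components `s x a b : (xa)b ⟶ (xb)a`. -/
class Braiding (C : Type u) [Category.{v} C] [SkewMonoidal C] where
  s (x a b : C) : ten (ten x a) b ⟶ ten (ten x b) a
  isIso_s (x a b : C) : IsIso (s x a b)
  s_nat {x x' a a' b b' : C} (f : x ⟶ x') (g : a ⟶ a') (h : b ⟶ b') :
    tenHom (tenHom f g) h ≫ s x' a' b' = s x a b ≫ tenHom (tenHom f h) g
  s_s (x a b c : C) :
    s (ten x a) b c ≫ tenHom (s x a c) (𝟙 b) ≫ s (ten x c) a b =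
      tenHom (s x a b) (𝟙 c) ≫ s (ten x b) a c ≫ tenHom (s x b c) (𝟙 a)
  s_al₁ (x a b c : C) :
    tenHom (s x a b) (𝟙 c) ≫ s (ten x b) a c ≫ tenHom (al x b c) (𝟙 a) =
      al (ten x a) b c ≫ s x a (ten b c)
  s_al₂ (x a b c : C) :
    s (ten x a) b c ≫ tenHom (s x a c) (𝟙 b) ≫ al (ten x c) a b =
      tenHom (al x a b) (𝟙 c) ≫ s x (ten a b) c
  al_s (x a b c : C) :
    tenHom (al x a b) (𝟙 c) ≫ al x (ten a b) c ≫ tenHom (𝟙 x) (s a b c) =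
      s (ten x a) b c ≫ tenHom (al x a c) (𝟙 b) ≫ al x (ten a c) b

attribute [instance] Braiding.isIso_s

open Braiding

section LeftNormalBraided

variable {C : Type u} [Category.{v} C] [SkewMonoidal C]

theorem tenHom_comp_assoc {a a' a'' b b' b'' z : C} (f : a ⟶ a') (f' : a' ⟶ a'') (g : b ⟶ b')
    (g' : b' ⟶ b'') (k : ten a'' b'' ⟶ z) :
    tenHom f g ≫ tenHom f' g' ≫ k = tenHom (f ≫ f') (g ≫ g') ≫ k := by
  rw [← Category.assoc, tenHom_comp]

theorem al_nat_assoc {a a' b b' c c' z : C} (f : a ⟶ a') (g : b ⟶ b') (h : c ⟶ c')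
    (k : ten a' (ten b' c') ⟶ z) :
    tenHom (tenHom f g) h ≫ al a' b' c' ≫ k = al a b c ≫ tenHom f (tenHom g h) ≫ k := by
  rw [← Category.assoc, al_nat, Category.assoc]

theorem s_nat_assoc [Braiding C] {x x' a a' b b' z : C} (f : x ⟶ x') (g : a ⟶ a') (h : b ⟶ b')
    (k : ten (ten x' b') a' ⟶ z) :
    tenHom (tenHom f g) h ≫ s x' a' b' ≫ k = s x a b ≫ tenHom (tenHom f h) g ≫ k := by
  rw [← Category.assoc, s_nat, Category.assoc]

instance {a a' b b' : C} (f : a ⟶ a') (g : b ⟶ b') [IsIso f] [IsIso g] : IsIso (tenHom f g) :=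
  ⟨tenHom (inv f) (inv g), by simp [tenHom_comp, tenHom_id], by simp [tenHom_comp, tenHom_id]⟩

theorem aib_ten (x a b : C) : tenHom (tenHom (rh x) (𝟙 a)) (𝟙 b) ≫ tenHom (al x one a) (𝟙 b) ≫
    tenHom (tenHom (𝟙 x) (lam a)) (𝟙 b) = 𝟙 _ := by
  simp [tenHom_comp, aib, tenHom_id]

variable [LeftNormal C] [Braiding C]

/-- The maps `ab ⟶ ba` obtained from `s` by left normality. -/
noncomputable def swap (a b : C) : ten a b ⟶ ten b a :=
  tenHom (inv (lam a)) (𝟙 b) ≫ s one a b ≫ tenHom (lam b) (𝟙 a)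

instance (a b : C) : IsIso (swap a b) := by unfold swap; infer_instance

theorem lam_swap (a b : C) :
    tenHom (lam a) (𝟙 b) ≫ swap a b = s one a b ≫ tenHom (lam b) (𝟙 a) := by
  simp [swap, tenHom_comp_assoc, tenHom_id]

instance isIso_al_one (a b : C) : IsIso (al one a b) := by
  have h : al one a b = tenHom (lam a) (𝟙 b) ≫ inv (lam (ten a b)) := by
    simp [← iab]
  rw [h]; infer_instance

instance isIso_al (a b c : C) : IsIso (al a b c) := by
  have h₁ : al (ten one a) b c =
      (tenHom (s one a b) (𝟙 c) ≫ s (ten one b) a c ≫ tenHom (al one b c) (𝟙 a)) ≫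
        inv (s one a (ten b c)) := by
    rw [s_al₁]; simp
  have h₂ : IsIso (al (ten one a) b c) := by rw [h₁]; infer_instance
  have h₃ : al a b c = inv (tenHom (tenHom (lam a) (𝟙 b)) (𝟙 c)) ≫
      al (ten one a) b c ≫ tenHom (lam a) (tenHom (𝟙 b) (𝟙 c)) := by
    rw [IsIso.eq_inv_comp, al_nat]
  rw [h₃]; infer_instance

theorem swap_nat {a a' b b' : C} (f : a ⟶ a') (g : b ⟶ b') :
    tenHom f g ≫ swap a' b' = swap a b ≫ tenHom g f := by
  rw [← cancel_epi (tenHom (lam a) (𝟙 b))]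
  have h : tenHom (lam a) (𝟙 b) ≫ tenHom f g =
      tenHom (tenHom (𝟙 one) f) g ≫ tenHom (lam a') (𝟙 b') := by
    simp [tenHom_comp, lam_nat]
  rw [reassoc_of% h, lam_swap, s_nat_assoc, reassoc_of% (lam_swap a b)]
  simp [tenHom_comp, lam_nat]

instance isIso_rh (a : C) : IsIso (rh a) := by
  have h₁ : IsIso (tenHom (rh a) (𝟙 one)) := by
    have : tenHom (rh a) (𝟙 (one : C)) = inv (al a one one ≫ tenHom (𝟙 a) (lam one)) := by
      rw [← cancel_mono (al a one one ≫ tenHom (𝟙 a) (lam one)), aib, IsIso.inv_hom_id]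
    rw [this]; infer_instance
  have h₂ : tenHom (𝟙 one) (rh a) =
      inv (swap a one) ≫ tenHom (rh a) (𝟙 one) ≫ swap (ten a one) one := by
    rw [swap_nat]; simp
  have h₃ : IsIso (tenHom (𝟙 one) (rh a)) := by rw [h₂]; infer_instance
  have h₄ : rh a = inv (lam a) ≫ tenHom (𝟙 one) (rh a) ≫ lam (ten a one) := by
    rw [lam_nat]; simp
  rw [h₄]; infer_instance

/-- The skew braiding `s` is the conjugate of `x ⊗ swap` by the associator. -/
theorem s_al (x a b : C) :
    s x a b ≫ al x b a = al x a b ≫ tenHom (𝟙 x) (swap a b) := by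
  calc s x a b ≫ al x b a
      = s x a b ≫ (tenHom (tenHom (rh x) (𝟙 b)) (𝟙 a) ≫ tenHom (al x one b) (𝟙 a) ≫
          tenHom (tenHom (𝟙 x) (lam b)) (𝟙 a)) ≫ al x b a := by rw [aib_ten]; simp
    _ = tenHom (tenHom (rh x) (𝟙 a)) (𝟙 b) ≫ (s (ten x one) a b ≫ tenHom (al x one b) (𝟙 a) ≫
          al x (ten one b) a) ≫ tenHom (𝟙 x) (tenHom (lam b) (𝟙 a)) := by
        simp only [Category.assoc, s_nat_assoc, al_nat]
    _ = tenHom (tenHom (rh x) (𝟙 a)) (𝟙 b) ≫ tenHom (al x one a) (𝟙 b) ≫ al x (ten one a) b ≫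
          tenHom (𝟙 x) (tenHom (lam a) (𝟙 b)) ≫ tenHom (𝟙 x) (swap a b) := by
        rw [← al_s]
        simp only [Category.assoc, tenHom_comp, lam_swap]
    _ = (tenHom (tenHom (rh x) (𝟙 a)) (𝟙 b) ≫ tenHom (al x one a) (𝟙 b) ≫
          tenHom (tenHom (𝟙 x) (lam a)) (𝟙 b)) ≫ al x a b ≫ tenHom (𝟙 x) (swap a b) := by
        simp only [Category.assoc, al_nat_assoc]
    _ = _ := by rw [aib_ten]; simp

theorem inv_lam_s (a b : C) :
    tenHom (inv (lam a)) (𝟙 b) ≫ s one a b = swap a b ≫ tenHom (inv (lam b)) (𝟙 a) := by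
  simp [swap, tenHom_comp, tenHom_id]

theorem swap_swap (h : ∀ x a b : C, s x a b ≫ s x b a = 𝟙 _) (a b : C) :
    swap a b ≫ swap b a = 𝟙 (ten a b) := by
  rw [← cancel_epi (tenHom (lam a) (𝟙 b)), reassoc_of% lam_swap, lam_swap, reassoc_of% h,
    Category.comp_id]

theorem hexagon₁ (a b c : C) : al a b c ≫ swap a (ten b c) ≫ al b c a =
    tenHom (swap a b) (𝟙 c) ≫ al b a c ≫ tenHom (𝟙 b) (swap a c) := by
  rw [← s_al, ← cancel_epi (tenHom (tenHom (lam a) (𝟙 b)) (𝟙 c))]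
  have h₁ : tenHom (tenHom (lam a) (𝟙 b)) (𝟙 c) ≫ al a b c ≫ swap a (ten b c) =
      tenHom (s one a b) (𝟙 c) ≫ s (ten one b) a c ≫
        tenHom (al one b c ≫ lam (ten b c)) (𝟙 a) := by
    rw [al_nat_assoc, tenHom_id, lam_swap, ← reassoc_of% s_al₁, tenHom_comp, Category.comp_id]
  rw [reassoc_of% h₁, iab, ← s_nat_assoc]
  simp only [tenHom_comp_assoc, lam_swap, Category.comp_id]

theorem hexagon₂ (a b c : C) : swap (ten a b) c = al a b c ≫ tenHom (𝟙 a) (swap b c) ≫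
    inv (al a c b) ≫ tenHom (swap a c) (𝟙 b) ≫ al c a b := by
  have h : al a b c ≫ tenHom (𝟙 a) (swap b c) ≫ inv (al a c b) = s a b c := by
    rw [← reassoc_of% (s_al a b c)]; simp
  rw [reassoc_of% h, ← cancel_epi (tenHom (tenHom (lam a) (𝟙 b)) (𝟙 c)), s_nat_assoc,
    tenHom_comp_assoc, lam_swap, Category.comp_id, ← iab,
    show tenHom (al one a b ≫ lam (ten a b)) (𝟙 c) =
      tenHom (al one a b) (𝟙 c) ≫ tenHom (lam (ten a b)) (𝟙 c) by simp [tenHom_comp],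
    Category.assoc, lam_swap, ← reassoc_of% s_al₂,
    show tenHom (s one a c ≫ tenHom (lam c) (𝟙 a)) (𝟙 b) =
      tenHom (s one a c) (𝟙 b) ≫ tenHom (tenHom (lam c) (𝟙 a)) (𝟙 b) by simp [tenHom_comp],
    Category.assoc, al_nat, tenHom_id]

variable (C)

/-- A left normal braided skew monoidal category is a monoidal category. -/
@[reducible] noncomputable def monoidalCategory : MonoidalCategory C :=
  letI : MonoidalCategoryStruct C :=
    { tensorObj := ten
      whiskerLeft := fun a _ _ f ↦ tenHom (𝟙 a) f
      whiskerRight := fun f b ↦ tenHom f (𝟙 b)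
      tensorHom := tenHom
      tensorUnit := one
      associator := fun a b c ↦ asIso (al a b c)
      leftUnitor := fun a ↦ asIso (lam a)
      rightUnitor := fun a ↦ (asIso (rh a)).symm }
  MonoidalCategory.ofTensorHom
    (id_tensorHom_id := tenHom_id)
    (id_tensorHom := fun _ _ _ _ ↦ rfl)
    (tensorHom_id := fun _ _ ↦ rfl)
    (tensorHom_comp_tensorHom := fun f₁ f₂ g₁ g₂ ↦ tenHom_comp f₁ g₁ f₂ g₂)
    (associator_naturality := al_nat)
    (leftUnitor_naturality := lam_nat)
    (rightUnitor_naturality := fun {a a'} f ↦ by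
      change tenHom f (𝟙 one) ≫ inv (rh a') = inv (rh a) ≫ f
      rw [IsIso.comp_inv_eq, Category.assoc, rh_nat, IsIso.inv_hom_id_assoc])
    (pentagon := abcd)
    (triangle := fun a b ↦ by
      change al a one b ≫ tenHom (𝟙 a) (lam b) = tenHom (inv (rh a)) (𝟙 b)
      rw [← cancel_epi (tenHom (rh a) (𝟙 b)), aib, tenHom_comp]
      simp [tenHom_id])

/-- The braiding of the monoidal category given by a left normal braided skew monoidal category. -/
@[reducible] noncomputable def braidedCategory :
    letI := monoidalCategory C
    BraidedCategory C :=
  letI := monoidalCategory C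
  { braiding := fun a b ↦ (asIso (swap a b) : ten a b ≅ ten b a)
    braiding_naturality_right := fun a _ _ f ↦ swap_nat (𝟙 a) f
    braiding_naturality_left := fun f b ↦ swap_nat f (𝟙 b)
    hexagon_forward := hexagon₁
    hexagon_reverse := fun a b c ↦ by
      change inv (al a b c) ≫ swap (ten a b) c ≫ inv (al c a b) =
        tenHom (𝟙 a) (swap b c) ≫ inv (al a c b) ≫ tenHom (swap a c) (𝟙 b)
      rw [hexagon₂]; simp }

end LeftNormalBraided

/-- A braided lax monoidal structure on a functor between braided skew monoidal categories. -/
structure LaxBraided {C : Type u₁} [Category.{v₁} C] [SkewMonoidal C] [Braiding C]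
    {D : Type u₂} [Category.{v₂} D] [SkewMonoidal D] [Braiding D] (F : C ⥤ D) where
  f₀ : one ⟶ F.obj one
  f₂ (a b : C) : ten (F.obj a) (F.obj b) ⟶ F.obj (ten a b)
  f₂_nat {a a' b b' : C} (g : a ⟶ a') (h : b ⟶ b') :
    tenHom (F.map g) (F.map h) ≫ f₂ a' b' = f₂ a b ≫ F.map (tenHom g h)
  f₂_al (a b c : C) : tenHom (f₂ a b) (𝟙 (F.obj c)) ≫ f₂ (ten a b) c ≫ F.map (al a b c) =
    al (F.obj a) (F.obj b) (F.obj c) ≫ tenHom (𝟙 (F.obj a)) (f₂ b c) ≫ f₂ a (ten b c)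
  f₂_lam (a : C) : tenHom f₀ (𝟙 (F.obj a)) ≫ f₂ one a ≫ F.map (lam a) = lam (F.obj a)
  f₂_rh (a : C) : rh (F.obj a) ≫ tenHom (𝟙 (F.obj a)) f₀ ≫ f₂ a one = F.map (rh a)
  f₂_s (x a b : C) : tenHom (f₂ x a) (𝟙 (F.obj b)) ≫ f₂ (ten x a) b ≫ F.map (s x a b) =
    s (F.obj x) (F.obj a) (F.obj b) ≫ tenHom (f₂ x b) (𝟙 (F.obj a)) ≫ f₂ (ten x b) a

section

variable {C : Type u₁} [Category.{v₁} C] [SkewMonoidal C] [Braiding C] [LeftNormal C]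
  {D : Type u₂} [Category.{v₂} D] [SkewMonoidal D] [Braiding D] [LeftNormal D]

theorem LaxBraided.f₂_swap {F : C ⥤ D} (L : LaxBraided F) (a b : C) :
    L.f₂ a b ≫ F.map (swap a b) = swap (F.obj a) (F.obj b) ≫ L.f₂ b a := by
  have key (a b : C) : tenHom (tenHom L.f₀ (𝟙 (F.obj a))) (𝟙 (F.obj b)) ≫
      tenHom (L.f₂ one a) (𝟙 (F.obj b)) ≫ L.f₂ (ten one a) b ≫ F.map (tenHom (lam a) (𝟙 b)) =
        tenHom (lam (F.obj a)) (𝟙 (F.obj b)) ≫ L.f₂ a b := by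
    rw [← L.f₂_nat, ← L.f₂_lam]
    simp [tenHom_comp_assoc]
  rw [← cancel_epi (tenHom (lam (F.obj a)) (𝟙 (F.obj b))), reassoc_of% lam_swap, ← key b a,
    ← s_nat_assoc, ← reassoc_of% L.f₂_s, ← F.map_comp, ← lam_swap, F.map_comp,
    ← reassoc_of% (key a b)]

/-- A braided lax monoidal functor between left normal braided skew monoidal categories is a braided
lax monoidal functor between the associated braided monoidal categories. -/
@[reducible] def LaxBraided.functorLaxBraided {F : C ⥤ D} (L : LaxBraided F) :
    letI := monoidalCategory C
    letI := braidedCategory C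
    letI := monoidalCategory D
    letI := braidedCategory D
    F.LaxBraided :=
  letI := monoidalCategory C
  letI := braidedCategory C
  letI := monoidalCategory D
  letI := braidedCategory D
  { ε := L.f₀
    μ := L.f₂
    μ_natural_left := fun f b ↦ by
      have := L.f₂_nat f (𝟙 b); rwa [F.map_id] at this
    μ_natural_right := fun b f ↦ by
      have := L.f₂_nat (𝟙 b) f; rwa [F.map_id] at this
    associativity := L.f₂_al
    left_unitality := fun a ↦ (L.f₂_lam a).symm
    right_unitality := fun a ↦ by
      change inv (rh (F.obj a)) = tenHom (𝟙 (F.obj a)) L.f₀ ≫ L.f₂ a one ≫ F.map (inv (rh a))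
      rw [← cancel_epi (rh (F.obj a)), reassoc_of% L.f₂_rh, IsIso.hom_inv_id, ← F.map_comp,
        IsIso.hom_inv_id, F.map_id]
    braided := L.f₂_swap }

end

end SkewMonoidal

namespace ShortMulticategory

section LeftRepresentable

variable {C : Type u} [Category.{v} C] [ShortMulticategory C]

/-- Postcomposition of a binary multimap with a unary one. -/
abbrev post₂ {a b c d : C} (q : c ⟶ d) (f : M₂ a b c) : M₂ a b d := act₂ (𝟙 a) (𝟙 b) q f

/-- Postcomposition of a ternary multimap with a unary one. -/
abbrev post₃ {a₁ a₂ a₃ b b' : C} (q : b ⟶ b') (f : M₃ a₁ a₂ a₃ b) : M₃ a₁ a₂ a₃ b' :=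
  act₃ (𝟙 a₁) (𝟙 a₂) (𝟙 a₃) q f

/-- Postcomposition of a quaternary multimap with a unary one. -/
abbrev post₄ {a₁ a₂ a₃ a₄ b b' : C} (q : b ⟶ b') (f : M₄ a₁ a₂ a₃ a₄ b) : M₄ a₁ a₂ a₃ a₄ b' :=
  act₄ (𝟙 a₁) (𝟙 a₂) (𝟙 a₃) (𝟙 a₄) q f

theorem post₃_comp {a₁ a₂ a₃ b b' b'' : C} (q : b ⟶ b') (q' : b' ⟶ b'') (f : M₃ a₁ a₂ a₃ b) :
    post₃ (q ≫ q') f = post₃ q' (post₃ q f) := by simp [post₃, act₃_comp]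

theorem post₄_comp {a₁ a₂ a₃ a₄ b b' b'' : C} (q : b ⟶ b') (q' : b' ⟶ b'')
    (f : M₄ a₁ a₂ a₃ a₄ b) : post₄ (q ≫ q') f = post₄ q' (post₄ q f) := by
  simp [post₄, act₄_comp]

theorem post₂_comp {a b c d e : C} (q : c ⟶ d) (q' : d ⟶ e) (f : M₂ a b c) :
    post₂ (q ≫ q') f = post₂ q' (post₂ q f) := by simp [post₂, act₂_comp]

theorem post_sub221 {a₁ a₂ b₁ b₂ c c' : C} (q : c ⟶ c') (g : M₂ b₁ b₂ c) (f : M₂ a₁ a₂ b₁) :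
    post₃ q (sub221 g f) = sub221 (post₂ q g) f := by
  rw [post₃, sub221_nat, act₂_id]

theorem post_sub222 {a₁ a₂ b₁ b₂ c c' : C} (q : c ⟶ c') (g : M₂ b₁ b₂ c) (f : M₂ a₁ a₂ b₂) :
    post₃ q (sub222 g f) = sub222 (post₂ q g) f := by
  rw [post₃, sub222_nat, act₂_id]

theorem post_sub321 {a₁ a₂ b₁ b₂ b₃ c c' : C} (q : c ⟶ c') (g : M₃ b₁ b₂ b₃ c)
    (f : M₂ a₁ a₂ b₁) : post₄ q (sub321 g f) = sub321 (post₃ q g) f := by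
  rw [post₄, sub321_nat, act₂_id]

theorem post_sub322 {a₁ a₂ b₁ b₂ b₃ c c' : C} (q : c ⟶ c') (g : M₃ b₁ b₂ b₃ c)
    (f : M₂ a₁ a₂ b₂) : post₄ q (sub322 g f) = sub322 (post₃ q g) f := by
  rw [post₄, sub322_nat, act₂_id]

theorem post_sub323 {a₁ a₂ b₁ b₂ b₃ c c' : C} (q : c ⟶ c') (g : M₃ b₁ b₂ b₃ c)
    (f : M₂ a₁ a₂ b₃) : post₄ q (sub323 g f) = sub323 (post₃ q g) f := by
  rw [post₄, sub323_nat, act₂_id]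

theorem post_sub231 {a₁ a₂ a₃ b₁ b₂ c c' : C} (q : c ⟶ c') (g : M₂ b₁ b₂ c)
    (f : M₃ a₁ a₂ a₃ b₁) : post₄ q (sub231 g f) = sub231 (post₂ q g) f := by
  rw [post₄, sub231_nat, act₃_id]

theorem post_sub232 {a₁ a₂ a₃ b₁ b₂ c c' : C} (q : c ⟶ c') (g : M₂ b₁ b₂ c)
    (f : M₃ a₁ a₂ a₃ b₂) : post₄ q (sub232 g f) = sub232 (post₂ q g) f := by
  rw [post₄, sub232_nat, act₃_id]

theorem post_act₂ {a a' b b' c c' : C} (p₁ : a' ⟶ a) (p₂ : b' ⟶ b) (q : c ⟶ c') (f : M₂ a b c) :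
    post₂ q (act₂ p₁ p₂ (𝟙 c) f) = act₂ p₁ p₂ q f := by simp [post₂, act₂_comp]

theorem act₂_post {a a' b b' c c' : C} (p₁ : a' ⟶ a) (p₂ : b' ⟶ b) (q : c ⟶ c') (f : M₂ a b c) :
    act₂ p₁ p₂ (𝟙 c') (post₂ q f) = act₂ p₁ p₂ q f := by simp [post₂, act₂_comp]

theorem act₃_post {a₁ a₁' a₂ a₂' a₃ a₃' b b' : C} (p₁ : a₁' ⟶ a₁) (p₂ : a₂' ⟶ a₂)
    (p₃ : a₃' ⟶ a₃) (q : b ⟶ b') (f : M₃ a₁ a₂ a₃ b) :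
    act₃ p₁ p₂ p₃ (𝟙 b') (post₃ q f) = act₃ p₁ p₂ p₃ q f := by simp [post₃, act₃_comp]

theorem post_act₃ {a₁ a₁' a₂ a₂' a₃ a₃' b b' : C} (p₁ : a₁' ⟶ a₁) (p₂ : a₂' ⟶ a₂)
    (p₃ : a₃' ⟶ a₃) (q : b ⟶ b') (f : M₃ a₁ a₂ a₃ b) :
    post₃ q (act₃ p₁ p₂ p₃ (𝟙 b) f) = act₃ p₁ p₂ p₃ q f := by simp [post₃, act₃_comp]

theorem sub201_comp {b₁ b₂ c c' : C} (g : M₂ b₁ b₂ c) (f : M₀ b₁) (q : c ⟶ c') :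
    sub201 g f ≫ q = sub201 (post₂ q g) f := by
  simpa using sub201_nat (𝟙 b₂) q g f

theorem sub202_comp {b₁ b₂ c c' : C} (g : M₂ b₁ b₂ c) (f : M₀ b₂) (q : c ⟶ c') :
    sub202 g f ≫ q = sub202 (post₂ q g) f := by
  simpa using sub202_nat (𝟙 b₁) q g f

theorem comp_sub201 {b₁ b₂ b₂' c : C} (r : b₂' ⟶ b₂) (g : M₂ b₁ b₂ c) (f : M₀ b₁) :
    r ≫ sub201 g f = sub201 (act₂ (𝟙 b₁) r (𝟙 c) g) f := by
  simpa using sub201_nat r (𝟙 c) g f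

theorem comp_sub202 {b₁ b₁' b₂ c : C} (r : b₁' ⟶ b₁) (g : M₂ b₁ b₂ c) (f : M₀ b₂) :
    r ≫ sub202 g f = sub202 (act₂ r (𝟙 b₂) (𝟙 c) g) f := by
  simpa using sub202_nat r (𝟙 c) g f

theorem post_sub302 {b₁ b₂ b₃ c c' : C} (q : c ⟶ c') (g : M₃ b₁ b₂ b₃ c) (f : M₀ b₂) :
    post₂ q (sub302 g f) = sub302 (post₃ q g) f := sub302_nat _ _ _ _ _

theorem post_sub303 {b₁ b₂ b₃ c c' : C} (q : c ⟶ c') (g : M₃ b₁ b₂ b₃ c) (f : M₀ b₃) :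
    post₂ q (sub303 g f) = sub303 (post₃ q g) f := sub303_nat _ _ _ _ _

theorem post_β₄₂ [ShortBraiding C] {a₁ a₂ a₃ a₄ b b' : C} (q : b ⟶ b') (f : M₄ a₁ a₂ a₃ a₄ b) :
    post₄ q (β₄₂ f) = β₄₂ (post₄ q f) := (β₄₂_nat _ _ _ _ _ _).symm

theorem post_β₄₃ [ShortBraiding C] {a₁ a₂ a₃ a₄ b b' : C} (q : b ⟶ b') (f : M₄ a₁ a₂ a₃ a₄ b) :
    post₄ q (β₄₃ f) = β₄₃ (post₄ q f) := (β₄₃_nat _ _ _ _ _ _).symm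

theorem post_β₃₂ [ShortBraiding C] {a₁ a₂ a₃ b b' : C} (q : b ⟶ b') (f : M₃ a₁ a₂ a₃ b) :
    post₃ q (β₃₂ f) = β₃₂ (post₃ q f) := (β₃₂_nat _ _ _ _ _).symm

variable [LeftRepresentable C]

/-- The object classifying nullary multimaps. -/
noncomputable def unit (C : Type u) [Category.{v} C] [ShortMulticategory C]
    [LeftRepresentable C] : C :=
  (LeftRepresentable.nullary (C := C)).choose

/-- The universal nullary multimap. -/
noncomputable def un (C : Type u) [Category.{v} C] [ShortMulticategory C]
    [LeftRepresentable C] : M₀ (unit C) :=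
  (LeftRepresentable.nullary (C := C)).choose_spec.choose

theorem un_universal : IsLeftUniversalNullary (un C) :=
  (LeftRepresentable.nullary (C := C)).choose_spec.choose_spec

/-- The object classifying binary multimaps out of `a`, `b`. -/
noncomputable def tens (a b : C) : C := (LeftRepresentable.binary a b).choose

/-- The universal binary multimap out of `a`, `b`. -/
noncomputable def th (a b : C) : M₂ a b (tens a b) :=
  (LeftRepresentable.binary a b).choose_spec.choose

theorem th_universal (a b : C) : IsLeftUniversalBinary (th a b) :=
  (LeftRepresentable.binary a b).choose_spec.choose_spec

/-- The universal ternary multimap. -/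
noncomputable def th₃ (a b c : C) : M₃ a b c (tens (tens a b) c) :=
  sub221 (th (tens a b) c) (th a b)

/-- The universal quaternary multimap. -/
noncomputable def th₄ (a b c d : C) : M₄ a b c d (tens (tens (tens a b) c) d) :=
  sub321 (th₃ (tens a b) c d) (th a b)

theorem th₄_eq (a b c d : C) : th₄ a b c d = sub231 (th (tens (tens a b) c) d) (th₃ a b c) := by
  rw [th₄, th₃, th₃, assoc2_11]

theorem hom_ext₂ {a b c : C} {f g : tens a b ⟶ c} (h : post₂ f (th a b) = post₂ g (th a b)) :
    f = g :=
  ((th_universal a b).bijective₂ c).injective h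

theorem bijective_th₃ (a b c d : C) :
    Function.Bijective fun f : tens (tens a b) c ⟶ d ↦ post₃ f (th₃ a b c) := by
  have := ((th_universal a b).bijective₃ c d).comp ((th_universal (tens a b) c).bijective₂ d)
  refine (congrArg _ (funext fun f ↦ ?_)).mp this
  exact (post_sub221 _ _ _).symm

theorem hom_ext₃ {a b c d : C} {f g : tens (tens a b) c ⟶ d}
    (h : post₃ f (th₃ a b c) = post₃ g (th₃ a b c)) : f = g :=
  (bijective_th₃ a b c d).injective h

theorem hom_ext₄ {a b c d e : C} {f g : tens (tens (tens a b) c) d ⟶ e}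
    (h : post₄ f (th₄ a b c d) = post₄ g (th₄ a b c d)) : f = g := by
  refine hom_ext₃ (((th_universal a b).bijective₄ c d e).injective ?_)
  simpa only [th₄, post_sub321] using h

/-- The morphism out of the tensor product induced by a binary multimap. -/
noncomputable def desc₂ {a b c : C} (f : M₂ a b c) : tens a b ⟶ c :=
  (((th_universal a b).bijective₂ c).surjective f).choose

@[simp] theorem post_desc₂ {a b c : C} (f : M₂ a b c) : post₂ (desc₂ f) (th a b) = f :=
  (((th_universal a b).bijective₂ c).surjective f).choose_spec

/-- The morphism out of the triple tensor product induced by a ternary multimap. -/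
noncomputable def desc₃ {a b c d : C} (f : M₃ a b c d) : tens (tens a b) c ⟶ d :=
  ((bijective_th₃ a b c d).surjective f).choose

@[simp] theorem post_desc₃ {a b c d : C} (f : M₃ a b c d) : post₃ (desc₃ f) (th₃ a b c) = f :=
  ((bijective_th₃ a b c d).surjective f).choose_spec

/-- The tensor product of morphisms. -/
noncomputable def tensHom {a a' b b' : C} (f : a ⟶ a') (g : b ⟶ b') : tens a b ⟶ tens a' b' :=
  desc₂ (act₂ f g (𝟙 _) (th a' b'))

theorem post_tensHom {a a' b b' : C} (f : a ⟶ a') (g : b ⟶ b') :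
    post₂ (tensHom f g) (th a b) = act₂ f g (𝟙 _) (th a' b') := post_desc₂ _

/-- The associator `α`, determined by `α ∘ (θ ∘₁ θ) = θ ∘₂ θ`. -/
noncomputable def assoc (a b c : C) : tens (tens a b) c ⟶ tens a (tens b c) :=
  desc₃ (sub222 (th a (tens b c)) (th b c))

theorem post_assoc (a b c : C) :
    post₃ (assoc a b c) (th₃ a b c) = sub222 (th a (tens b c)) (th b c) := post_desc₃ _

theorem bijective_unit (a b : C) :
    Function.Bijective fun f : tens (unit C) a ⟶ b ↦
      sub201 (th (unit C) a) (un C) ≫ f := by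
  have := ((un_universal (C := C)).bijective₁ a b).comp ((th_universal (unit C) a).bijective₂ b)
  refine (congrArg _ (funext fun f ↦ ?_)).mp this
  simpa using (sub201_nat (𝟙 a) f (th (unit C) a) (un C)).symm

/-- The left unit map `λ`, determined by `(λ ∘ θ) ∘₁ u = 1`. -/
noncomputable def leftUnit (a : C) : tens (unit C) a ⟶ a :=
  ((bijective_unit a a).surjective (𝟙 a)).choose

theorem th_leftUnit (a : C) : sub201 (th (unit C) a) (un C) ≫ leftUnit a = 𝟙 a :=
  ((bijective_unit a a).surjective (𝟙 a)).choose_spec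

theorem leftUnit_th (a : C) : leftUnit a ≫ sub201 (th (unit C) a) (un C) = 𝟙 _ :=
  (bijective_unit a _).injective (by
    rw [reassoc_of% (th_leftUnit a), Category.comp_id])

/-- The right unit map `ρ = θ ∘₂ u`. -/
noncomputable def rightUnit (a : C) : a ⟶ tens a (unit C) := sub202 (th a (unit C)) (un C)

theorem post_tensHom₃ {a a' b b' c c' : C} (f : a ⟶ a') (g : b ⟶ b') (h : c ⟶ c') :
    post₃ (tensHom (tensHom f g) h) (th₃ a b c) = act₃ f g h (𝟙 _) (th₃ a' b' c') := by
  rw [th₃, post_sub221, post_tensHom, th₃, sub221_nat, ← post_tensHom f g, ← sub221_dinat,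
    act₂_comp]
  simp

-- the effect of the structure maps on the universal ternary and quaternary multimaps

theorem post_tensHom_sub231 {a₁ a₂ a₃ b b' c : C} (f : b ⟶ b') (t : M₃ a₁ a₂ a₃ b) :
    post₄ (tensHom f (𝟙 c)) (sub231 (th b c) t) = sub231 (th b' c) (post₃ f t) := by
  rw [post_sub231, post_tensHom, sub231_dinat]

theorem post_tensHom_sub232 {a₁ a₂ a₃ b b' c : C} (f : b ⟶ b') (t : M₃ a₁ a₂ a₃ b) :
    post₄ (tensHom (𝟙 c) f) (sub232 (th c b) t) = sub232 (th c b') (post₃ f t) := by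
  rw [post_sub232, post_tensHom, sub232_dinat]

theorem post_tensHom_sub221 {a₁ a₂ b b' c : C} (f : b ⟶ b') (t : M₂ a₁ a₂ b) :
    post₃ (tensHom f (𝟙 c)) (sub221 (th b c) t) = sub221 (th b' c) (post₂ f t) := by
  rw [post_sub221, post_tensHom, sub221_dinat]

theorem post_tensHom_sub222 {a₁ a₂ b b' c : C} (f : b ⟶ b') (t : M₂ a₁ a₂ b) :
    post₃ (tensHom (𝟙 c) f) (sub222 (th c b) t) = sub222 (th c b') (post₂ f t) := by
  rw [post_sub222, post_tensHom, sub222_dinat]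

theorem post_assoc_th₄ (a b c d : C) : post₄ (assoc (tens a b) c d) (th₄ a b c d) =
    sub323 (th₃ a b (tens c d)) (th c d) := by
  rw [th₄, post_sub321, post_assoc, th₃, ← comm_22]

theorem post_assoc_tensHom_th₄ (a b c d : C) :
    post₄ (tensHom (assoc a b c) (𝟙 d)) (th₄ a b c d) =
      sub322 (th₃ a (tens b c) d) (th b c) := by
  rw [th₄_eq, post_tensHom_sub231, post_assoc, assoc2_12, th₃]

/-- The skew monoidal category associated with a left representable short multicategory. -/
@[reducible] noncomputable def skewMonoidal (C : Type u) [Category.{v} C] [ShortMulticategory C]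
    [LeftRepresentable C] : SkewMonoidal C where
  ten := tens
  tenHom := tensHom
  one := unit C
  al := assoc
  lam := leftUnit
  rh := rightUnit
  tenHom_id a b := hom_ext₂ (by rw [post_tensHom])
  tenHom_comp f f' g g' := hom_ext₂ (by
    rw [post₂_comp, post_tensHom, post_act₂, post_tensHom, ← act₂_post, post_tensHom, act₂_comp,
      Category.comp_id])
  al_nat f g h := hom_ext₃ (by
    rw [post₃_comp, post₃_comp, post_tensHom₃, post_assoc, post_act₃, ← act₃_post, post_assoc,
      post_sub222, post_tensHom, sub222_nat, ← post_tensHom g h, ← sub222_dinat, act₂_comp]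
    simp)
  lam_nat {a a'} f := by
    have h : sub201 (th (unit C) a) (un C) ≫ tensHom (𝟙 (unit C)) f =
        f ≫ sub201 (th (unit C) a') (un C) := by
      rw [sub201_comp, post_tensHom, comp_sub201]
    refine (bijective_unit a a').injective ?_
    rw [reassoc_of% h, th_leftUnit, reassoc_of% (th_leftUnit a), Category.comp_id]
  rh_nat {a a'} f := by
    rw [rightUnit, rightUnit, sub202_comp, post_tensHom, comp_sub202]
  abcd a b c d := hom_ext₄ (by
    simp only [post₄_comp]
    rw [post_assoc_tensHom_th₄, post_sub322, post_assoc, ← assoc2_21, ← th₃, post_tensHom_sub232,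
      post_assoc, post_assoc_th₄, post_sub323, post_assoc, assoc2_22])
  iab a b := hom_ext₃ (((un_universal (C := C)).bijective₂ a b _).injective (by
    rw [post₃_comp, post_assoc, post_sub222, ← comm_02, ← sub201_comp, th_leftUnit, act₂_id, th₃,
      post_tensHom_sub221, ← assoc0_11, ← sub201_comp, th_leftUnit, act₂_id]))
  abi a b := hom_ext₂ (by
    rw [post₂_comp, rightUnit, show post₂ (sub202 (th (tens a b) (unit C)) (un C)) (th a b) =
      sub303 (th₃ a b (unit C)) (un C) from (comm_20 _ _ _).symm, post_sub303, post_assoc,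
      post_tensHom, ← assoc0_22, rightUnit])
  aib a b := hom_ext₂ (by
    rw [post₂_comp, post₂_comp, post_tensHom, rightUnit, assoc0_12, ← th₃, post_sub302,
      post_assoc, post_sub302, post_tensHom_sub222, ← assoc0_21, ← sub201_comp, th_leftUnit,
      act₂_id, post₂, act₂_id])
  ii := ((un_universal (C := C)).bijective₀ _).injective (by
    rw [rightUnit, sub202_comp, ← comm_00, ← sub201_comp, th_leftUnit])

theorem leftNormal (C : Type u) [Category.{v} C] [ShortMulticategory C] [LeftRepresentable C] :
    letI := skewMonoidal C
    SkewMonoidal.LeftNormal C :=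
  letI := skewMonoidal C
  ⟨fun a ↦ ⟨sub201 (th (unit C) a) (un C), leftUnit_th a, th_leftUnit a⟩⟩

variable [ShortBraiding C]

/-- The map `s : (xa)b ⟶ (xb)a`, determined by `s ∘ (θ ∘₁ θ) = β₃₂ (θ ∘₁ θ)`. -/
noncomputable def sw (x a b : C) : tens (tens x a) b ⟶ tens (tens x b) a := desc₃ (β₃₂ (th₃ x b a))

theorem post_sw (x a b : C) : post₃ (sw x a b) (th₃ x a b) = β₃₂ (th₃ x b a) := post_desc₃ _

theorem post_sw_th₄ (x a b c : C) :
    post₄ (sw (tens x a) b c) (th₄ x a b c) = β₄₃ (th₄ x a c b) := by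
  rw [th₄, post_sub321, post_sw, ← β₄₃_sub321, th₄]

theorem post_tensHom_sw_th₄ (x a b c : C) :
    post₄ (tensHom (sw x a b) (𝟙 c)) (th₄ x a b c) = β₄₂ (th₄ x b a c) := by
  rw [th₄_eq, post_tensHom_sub231, post_sw, sub231_β₃₂, th₄_eq]

theorem isIso_sw (x a b : C) : IsIso (sw x a b) := by
  obtain ⟨t, ht⟩ : ∃ t : tens (tens x b) a ⟶ tens (tens x a) b,
      post₃ t (th₃ x b a) = β₃₂.symm (th₃ x a b) := ⟨desc₃ _, post_desc₃ _⟩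
  refine ⟨t, hom_ext₃ ?_, hom_ext₃ (β₃₂.injective ?_)⟩
  · rw [post₃_comp, post_sw, post_β₃₂, ht, Equiv.apply_symm_apply, post₃, act₃_id]
  · rw [post₃_comp, ht, ← post_β₃₂, Equiv.apply_symm_apply, post_sw, post₃, act₃_id]

theorem sw_sw (h : IsShortSymmetry C) (x a b : C) : sw x a b ≫ sw x b a = 𝟙 _ :=
  hom_ext₃ (by rw [post₃_comp, post_sw, post_β₃₂, post_sw, h, post₃, act₃_id])

/-- The braiding on the skew monoidal category associated with a left representable braided short
multicategory. -/
@[reducible] noncomputable def skewBraiding (C : Type u) [Category.{v} C] [ShortMulticategory C]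
    [LeftRepresentable C] [ShortBraiding C] :
    letI := skewMonoidal C
    SkewMonoidal.Braiding C :=
  letI := skewMonoidal C
  { s := sw
    isIso_s := isIso_sw
    s_nat := fun {x x' a a' b b'} f g h ↦ hom_ext₃ (by
      change post₃ (tensHom (tensHom f g) h ≫ sw x' a' b') (th₃ x a b) =
        post₃ (sw x a b ≫ tensHom (tensHom f h) g) (th₃ x a b)
      rw [post₃_comp, post₃_comp, post_tensHom₃, post_act₃, ← act₃_post, post_sw, post_sw,
        post_β₃₂, post_tensHom₃, β₃₂_nat])
    s_s := fun x a b c ↦ hom_ext₄ (by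
      change post₄ (sw (tens x a) b c ≫ tensHom (sw x a c) (𝟙 b) ≫ sw (tens x c) a b)
        (th₄ x a b c) = post₄ (tensHom (sw x a b) (𝟙 c) ≫ sw (tens x b) a c ≫
          tensHom (sw x b c) (𝟙 a)) (th₄ x a b c)
      simp only [post₄_comp, post_sw_th₄, post_β₄₃, post_tensHom_sw_th₄, post_β₄₂, yang_baxter])
    s_al₁ := fun x a b c ↦ hom_ext₄ (by
      change post₄ (tensHom (sw x a b) (𝟙 c) ≫ sw (tens x b) a c ≫ tensHom (assoc x b c) (𝟙 a))
        (th₄ x a b c) = post₄ (assoc (tens x a) b c ≫ sw x a (tens b c)) (th₄ x a b c)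
      simp only [post₄_comp, post_sw_th₄, post_β₄₃, post_tensHom_sw_th₄, post_β₄₂,
        post_assoc_th₄, post_assoc_tensHom_th₄, post_sub323, post_sw, β₄₂_β₄₃_sub322])
    s_al₂ := fun x a b c ↦ hom_ext₄ (by
      change post₄ (sw (tens x a) b c ≫ tensHom (sw x a c) (𝟙 b) ≫ assoc (tens x c) a b)
        (th₄ x a b c) = post₄ (tensHom (assoc x a b) (𝟙 c) ≫ sw x (tens a b) c) (th₄ x a b c)
      simp only [post₄_comp, post_sw_th₄, post_β₄₃, post_tensHom_sw_th₄, post_β₄₂,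
        post_assoc_th₄, post_assoc_tensHom_th₄, post_sub322, post_sw, β₄₃_β₄₂_sub323])
    al_s := fun x a b c ↦ hom_ext₄ (by
      change post₄ (tensHom (assoc x a b) (𝟙 c) ≫ assoc x (tens a b) c ≫ tensHom (𝟙 x) (sw a b c))
        (th₄ x a b c) = post₄ (sw (tens x a) b c ≫ tensHom (assoc x a c) (𝟙 b) ≫
          assoc x (tens a c) b) (th₄ x a b c)
      rw [post₄_comp, post₄_comp, post₄_comp, post₄_comp, post_assoc_tensHom_th₄, post_sub322,
        post_assoc, ← assoc2_21, ← th₃, post_tensHom_sub232, post_sw, post_sw_th₄, post_β₄₃,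
        post_β₄₃, post_assoc_tensHom_th₄, post_sub322, post_assoc, ← assoc2_21, ← th₃,
        sub232_β₃₂]) }

end LeftRepresentable

section Functor

variable {C : Type u₁} [Category.{v₁} C] [ShortMulticategory C]
  {D : Type u₂} [Category.{v₂} D] [ShortMulticategory D]

theorem map_post₂ (F : ShortMultifunctor C D) {a b c d : C} (q : c ⟶ d) (f : M₂ a b c) :
    F.map₂ (post₂ q f) = post₂ (F.map q) (F.map₂ f) := by
  simp [post₂, F.map₂_act]

theorem map_post₃ (F : ShortMultifunctor C D) {a₁ a₂ a₃ b b' : C} (q : b ⟶ b')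
    (f : M₃ a₁ a₂ a₃ b) : F.map₃ (post₃ q f) = post₃ (F.map q) (F.map₃ f) := by
  simp [post₃, F.map₃_act]

variable [LeftRepresentable C] [LeftRepresentable D]

/-- The unit comparison `f₀`, determined by `f₀ ∘ u = F u`. -/
noncomputable def comparison₀ (F : ShortMultifunctor C D) : unit D ⟶ F.obj (unit C) :=
  (((un_universal (C := D)).bijective₀ _).surjective (F.map₀ (un C))).choose

theorem act_comparison₀ (F : ShortMultifunctor C D) :
    act₀ (comparison₀ F) (un D) = F.map₀ (un C) :=
  (((un_universal (C := D)).bijective₀ _).surjective (F.map₀ (un C))).choose_spec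

/-- The tensor comparison `f₂`, determined by `f₂ ∘ θ = F θ`. -/
noncomputable def comparison₂ (F : ShortMultifunctor C D) (a b : C) :
    tens (F.obj a) (F.obj b) ⟶ F.obj (tens a b) :=
  desc₂ (F.map₂ (th a b))

theorem post_comparison₂ (F : ShortMultifunctor C D) (a b : C) :
    post₂ (comparison₂ F a b) (th (F.obj a) (F.obj b)) = F.map₂ (th a b) := post_desc₂ _

theorem comparison₀_id : comparison₀ (ShortMultifunctor.id C) = 𝟙 (unit C) :=
  ((un_universal (C := C)).bijective₀ _).injective
    ((act_comparison₀ _).trans (act₀_id _).symm)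

theorem comparison₂_id (a b : C) : comparison₂ (ShortMultifunctor.id C) a b = 𝟙 (tens a b) :=
  hom_ext₂ ((post_comparison₂ _ a b).trans (act₂_id _).symm)

theorem comparison₀_comp {E : Type u₃} [Category.{v₃} E] [ShortMulticategory E]
    [LeftRepresentable E] (F : ShortMultifunctor C D) (G : ShortMultifunctor D E) :
    comparison₀ (F.comp G) = comparison₀ G ≫ G.map (comparison₀ F) :=
  ((un_universal (C := E)).bijective₀ _).injective (by
    refine (act_comparison₀ _).trans ?_
    have h := G.map₀_act (comparison₀ F) (un D)
    rw [act_comparison₀, ← act_comparison₀ G, act₀_comp] at h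
    exact h)

theorem comparison₂_comp {E : Type u₃} [Category.{v₃} E] [ShortMulticategory E]
    [LeftRepresentable E] (F : ShortMultifunctor C D) (G : ShortMultifunctor D E) (a b : C) :
    comparison₂ (F.comp G) a b =
      comparison₂ G (F.obj a) (F.obj b) ≫ G.map (comparison₂ F a b) :=
  hom_ext₂ (by
    refine (post_comparison₂ _ a b).trans ?_
    have h := map_post₂ G (comparison₂ F a b) (th (F.obj a) (F.obj b))
    rw [post_comparison₂, ← post_comparison₂ G, ← post₂_comp] at h
    exact h)

theorem post_comparison₃ (F : ShortMultifunctor C D) (a b c : C) :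
    post₃ (tensHom (comparison₂ F a b) (𝟙 (F.obj c)) ≫ comparison₂ F (tens a b) c)
      (th₃ (F.obj a) (F.obj b) (F.obj c)) = F.map₃ (th₃ a b c) := by
  rw [post₃_comp, th₃, post_tensHom_sub221, post_sub221, post_comparison₂, post_comparison₂,
    ← F.map_sub221, ← th₃]

variable [ShortBraiding C] [ShortBraiding D]

/-- The braided lax monoidal structure, with respect to the braided skew monoidal structures
associated with left representable braided short multicategories, of a braided morphism. -/
@[reducible] noncomputable def laxBraided (F : ShortMultifunctor C D) (hF : F.IsBraided) :
    letI := skewMonoidal C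
    letI := skewMonoidal D
    letI := skewBraiding C
    letI := skewBraiding D
    SkewMonoidal.LaxBraided F.toFunctor :=
  letI := skewMonoidal C
  letI := skewMonoidal D
  letI := skewBraiding C
  letI := skewBraiding D
  { f₀ := comparison₀ F
    f₂ := comparison₂ F
    f₂_nat := fun {a a' b b'} g h ↦ hom_ext₂ (by
      change post₂ (tensHom (F.map g) (F.map h) ≫ comparison₂ F a' b') (th (F.obj a) (F.obj b)) =
        post₂ (comparison₂ F a b ≫ F.map (tensHom g h)) (th (F.obj a) (F.obj b))
      rw [post₂_comp, post₂_comp, post_tensHom, post_comparison₂, ← map_post₂, post_tensHom,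
        F.map₂_act, post_act₂, ← act₂_post, post_comparison₂, F.map_id])
    f₂_al := fun a b c ↦ hom_ext₃ (by
      change post₃ (tensHom (comparison₂ F a b) (𝟙 (F.obj c)) ≫ comparison₂ F (tens a b) c ≫
          F.map (assoc a b c)) (th₃ (F.obj a) (F.obj b) (F.obj c)) =
        post₃ (assoc (F.obj a) (F.obj b) (F.obj c) ≫ tensHom (𝟙 (F.obj a)) (comparison₂ F b c) ≫
          comparison₂ F a (tens b c)) (th₃ (F.obj a) (F.obj b) (F.obj c))
      rw [← Category.assoc, post₃_comp, post_comparison₃, ← map_post₃, post_assoc, F.map_sub222,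
        post₃_comp, post_assoc, post₃_comp, post_tensHom_sub222, post_sub222, post_comparison₂,
        post_comparison₂])
    f₂_lam := fun a ↦ (bijective_unit (F.obj a) (F.obj a)).injective (by
      change sub201 _ _ ≫ tensHom (comparison₀ F) (𝟙 (F.obj a)) ≫ comparison₂ F (unit C) a ≫
        F.map (leftUnit a) = sub201 _ _ ≫ leftUnit (F.obj a)
      rw [th_leftUnit, ← Category.assoc, sub201_comp, post_tensHom, sub201_dinat, act_comparison₀,
        ← Category.assoc, sub201_comp, post_comparison₂, ← F.map_sub201, ← F.map_comp,
        th_leftUnit, F.map_id])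
    f₂_rh := fun a ↦ by
      change rightUnit (F.obj a) ≫ tensHom (𝟙 (F.obj a)) (comparison₀ F) ≫
        comparison₂ F a (unit C) = F.map (rightUnit a)
      rw [rightUnit, ← Category.assoc, sub202_comp, post_tensHom, sub202_dinat, act_comparison₀,
        sub202_comp, post_comparison₂, ← F.map_sub202, ← rightUnit]
    f₂_s := fun x a b ↦ hom_ext₃ (by
      change post₃ (tensHom (comparison₂ F x a) (𝟙 (F.obj b)) ≫ comparison₂ F (tens x a) b ≫
          F.map (sw x a b)) (th₃ (F.obj x) (F.obj a) (F.obj b)) =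
        post₃ (sw (F.obj x) (F.obj a) (F.obj b) ≫ tensHom (comparison₂ F x b) (𝟙 (F.obj a)) ≫
          comparison₂ F (tens x b) a) (th₃ (F.obj x) (F.obj a) (F.obj b))
      rw [← Category.assoc, post₃_comp, post_comparison₃, ← map_post₃, post_sw, post₃_comp,
        post_sw, post_β₃₂, post_comparison₃, hF.map_β₃₂]) }

end Functor

end ShortMulticategory

/-- A bundled braided short multicategory. -/
structure BrdShortMulticat where
  carrier : Type u
  [category : Category.{v} carrier]
  [shortMulticategory : ShortMulticategory carrier]
  [shortBraiding : ShortBraiding carrier]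

namespace BrdShortMulticat

attribute [instance] category shortMulticategory shortBraiding

/-- The category of braided short multicategories and braided morphisms of short multicategories. -/
instance : Category BrdShortMulticat.{v, u} where
  Hom X Y := { F : ShortMultifunctor X.carrier Y.carrier // F.IsBraided }
  id X := ⟨ShortMultifunctor.id X.carrier, fun _ ↦ rfl, fun _ ↦ rfl, fun _ ↦ rfl⟩
  comp F G := ⟨F.1.comp G.1,
    fun f ↦ (congrArg G.1.map₃ (F.2.map_β₃₂ f)).trans (G.2.map_β₃₂ _),
    fun f ↦ (congrArg G.1.map₄ (F.2.map_β₄₂ f)).trans (G.2.map_β₄₂ _),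
    fun f ↦ (congrArg G.1.map₄ (F.2.map_β₄₃ f)).trans (G.2.map_β₄₃ _)⟩

end BrdShortMulticat

/-- The category of left representable braided short multicategories. -/
abbrev BrdShortMulticatLR :=
  ObjectProperty.FullSubcategory fun X : BrdShortMulticat.{v, u} ↦ LeftRepresentable X.carrier

/-- The category of left representable symmetric short multicategories. -/
abbrev SymShortMulticatLR :=
  ObjectProperty.FullSubcategory fun X : BrdShortMulticatLR.{v, u} ↦ IsShortSymmetry X.obj.carrier

/-- A bundled braided monoidal category. -/
structure BrdMonCat where
  carrier : Type u
  [category : Category.{v} carrier]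
  [monoidalCategory : MonoidalCategory carrier]
  [braidedCategory : BraidedCategory carrier]

namespace BrdMonCat

attribute [instance] category monoidalCategory braidedCategory

theorem laxBraidedFunctor_eq {C : Type u₁} [Category.{v₁} C] [MonoidalCategory C]
    [BraidedCategory C] {D : Type u₂} [Category.{v₂} D] [MonoidalCategory D] [BraidedCategory D]
    (F G : LaxBraidedFunctor C D) (L : F.toFunctor.LaxBraided) (hG : G = ⟨F.toFunctor, L⟩)
    (hε : @Functor.LaxMonoidal.ε _ _ _ _ _ _ F.toFunctor F.laxBraided.toLaxMonoidal =
      @Functor.LaxMonoidal.ε _ _ _ _ _ _ F.toFunctor L.toLaxMonoidal)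
    (hμ : ∀ a b, @Functor.LaxMonoidal.μ _ _ _ _ _ _ F.toFunctor F.laxBraided.toLaxMonoidal a b =
      @Functor.LaxMonoidal.μ _ _ _ _ _ _ F.toFunctor L.toLaxMonoidal a b) : F = G := by
  subst hG
  obtain ⟨F, ⟨_⟩⟩ := F
  obtain ⟨_⟩ := L
  congr
  exact Functor.LaxMonoidal.ext hε (funext fun a ↦ funext fun b ↦ hμ a b)

/-- The category of braided monoidal categories and braided lax monoidal functors. -/
instance : Category BrdMonCat.{v, u} where
  Hom X Y := LaxBraidedFunctor X.carrier Y.carrier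
  id X := LaxBraidedFunctor.of (𝟭 X.carrier)
  comp F G := LaxBraidedFunctor.of (F.toFunctor ⋙ G.toFunctor)
  id_comp F := laxBraidedFunctor_eq _ _ F.laxBraided rfl
    (show Functor.LaxMonoidal.ε F.toFunctor ≫ F.map (𝟙 _) = Functor.LaxMonoidal.ε F.toFunctor by simp)
    (fun a b ↦ show Functor.LaxMonoidal.μ F.toFunctor a b ≫ F.map (𝟙 _) =
      Functor.LaxMonoidal.μ F.toFunctor a b by simp)
  comp_id F := laxBraidedFunctor_eq _ _ F.laxBraided rfl
    (show 𝟙 _ ≫ Functor.LaxMonoidal.ε F.toFunctor = Functor.LaxMonoidal.ε F.toFunctor by simp)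
    (fun a b ↦ show 𝟙 _ ≫ Functor.LaxMonoidal.μ F.toFunctor a b =
      Functor.LaxMonoidal.μ F.toFunctor a b by simp)
  assoc F G H := laxBraidedFunctor_eq _ _
    (LaxBraidedFunctor.of (F.toFunctor ⋙ G.toFunctor ⋙ H.toFunctor)).laxBraided rfl
    (show Functor.LaxMonoidal.ε H.toFunctor ≫ H.map (Functor.LaxMonoidal.ε G.toFunctor ≫
        G.map (Functor.LaxMonoidal.ε F.toFunctor)) =
      (Functor.LaxMonoidal.ε H.toFunctor ≫ H.map (Functor.LaxMonoidal.ε G.toFunctor)) ≫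
        H.map (G.map (Functor.LaxMonoidal.ε F.toFunctor)) by simp)
    (fun a b ↦ show Functor.LaxMonoidal.μ H.toFunctor _ _ ≫
        H.map (Functor.LaxMonoidal.μ G.toFunctor _ _ ≫
          G.map (Functor.LaxMonoidal.μ F.toFunctor a b)) =
      (Functor.LaxMonoidal.μ H.toFunctor _ _ ≫ H.map (Functor.LaxMonoidal.μ G.toFunctor _ _)) ≫
        H.map (G.map (Functor.LaxMonoidal.μ F.toFunctor a b)) by simp)

end BrdMonCat

/-- The category of symmetric monoidal categories, as a full subcategory of the category of braided
monoidal categories. -/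
abbrev SymMonCat :=
  ObjectProperty.FullSubcategory fun X : BrdMonCat.{v, u} ↦
    ∀ a b : X.carrier, (β_ a b).hom ≫ (β_ b a).hom = 𝟙 (a ⊗ b)

/-- The braided monoidal category associated with a left representable braided short multicategory:
its braided skew monoidal category, with `s ∘ (θ ∘₁ θ) = β₃₂ (θ ∘₁ θ)`, is left normal, and hence is
a braided monoidal category. -/
noncomputable def kBrdObj (C : Type u) [Category.{v} C] [ShortMulticategory C] [ShortBraiding C]
    [LeftRepresentable C] : BrdMonCat.{v, u} :=
  letI := skewMonoidal C
  letI := skewBraiding C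
  haveI := leftNormal C
  { carrier := C
    monoidalCategory := SkewMonoidal.monoidalCategory C
    braidedCategory := SkewMonoidal.braidedCategory C }

/-- The braided lax monoidal functor associated with a braided morphism `F` of left representable
braided short multicategories: the underlying functor of `F` with the comparison maps `f₀`, `f₂`
such that `f₀ ∘ u = F u` and `f₂ ∘ θ = F θ`. -/
noncomputable def kBrdMap {C : Type u₁} [Category.{v₁} C] [ShortMulticategory C] [ShortBraiding C]
    [LeftRepresentable C] {D : Type u₁} [Category.{v₁} D] [ShortMulticategory D] [ShortBraiding D]
    [LeftRepresentable D] (F : ShortMultifunctor C D) (hF : F.IsBraided) :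
    kBrdObj C ⟶ kBrdObj D :=
  letI := skewMonoidal C
  letI := skewBraiding C
  haveI := leftNormal C
  letI := skewMonoidal D
  letI := skewBraiding D
  haveI := leftNormal D
  { toFunctor := F.toFunctor
    laxBraided := (laxBraided F hF).functorLaxBraided }

/-- The functor `K` from left representable braided short multicategories to braided monoidal
categories. -/
noncomputable def kBrd : BrdShortMulticatLR.{v, u} ⥤ BrdMonCat.{v, u} where
  obj X := haveI := X.property; kBrdObj X.obj.carrier
  map {X Y} F := haveI := X.property; haveI := Y.property; kBrdMap F.hom.1 F.hom.2
  map_id X :=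
    have := X.property
    BrdMonCat.laxBraidedFunctor_eq _ _ (LaxBraidedFunctor.laxBraided (𝟙 (kBrdObj X.obj.carrier)))
      rfl (comparison₀_id (C := X.obj.carrier)) (comparison₂_id (C := X.obj.carrier))
  map_comp {X Y Z} F G :=
    have := X.property
    have := Y.property
    have := Z.property
    BrdMonCat.laxBraidedFunctor_eq _ _
      (LaxBraidedFunctor.laxBraided (kBrdMap F.hom.1 F.hom.2 ≫ kBrdMap G.hom.1 G.hom.2))
      rfl (comparison₀_comp F.hom.1 G.hom.1) (comparison₂_comp F.hom.1 G.hom.1)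

theorem kBrd_symmetric (X : SymShortMulticatLR.{v, u}) (a b : (kBrd.obj X.obj).carrier) :
    (β_ a b).hom ≫ (β_ b a).hom = 𝟙 (a ⊗ b) :=
  have := X.obj.property
  letI := skewMonoidal X.obj.obj.carrier
  letI := skewBraiding X.obj.obj.carrier
  have := leftNormal X.obj.obj.carrier
  SkewMonoidal.swap_swap (fun x a b ↦ sw_sw X.property x a b) a b

/-- The restriction of `K` to left representable symmetric short multicategories. -/
noncomputable def kSym : SymShortMulticatLR.{v, u} ⥤ SymMonCat.{v, u} :=
  ObjectProperty.lift _ (ObjectProperty.ι _ ⋙ kBrd) kBrd_symmetric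

/-! `kBrd` is shown to be fully faithful and essentially surjective; the symmetric statement follows
because both categories there are full subcategories and the object constructions preserve symmetry.

Essential surjectivity. In a braided monoidal category `V`, take as `n`-ary multimaps the morphisms
out of the left-bracketed `n`-fold tensor product. The axioms of a short multicategory then become
naturality of the structural isomorphisms together with the pentagon, the triangle and the unit
coherences. The short braiding is precomposition with `swapLast`, the map `(xa)b ≅ (xb)a` that
interchanges the last two factors; its axioms are the Yang–Baxter equation and the two hexagons,
whiskered by an object. Identities are universal multimaps, so the result is left representable.
Since `K` works with arbitrarily chosen universal multimaps, it returns `V` only up to isomorphism: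
the chosen multimaps are invertible morphisms `unHom` and `thHom` of `V`, and these form a lax
structure on the identity functor (`comparisonIso`). The point that needs work is the braiding,
`thHom_swap`.

Full faithfulness. In a left representable short multicategory every multimap is uniquely a unary
map after a universal one, and the universal ones are built from `u` and `θ`. Hence a morphism is
determined by its functor and its values on `u` and `θ`, that is, by `f₀` and `f₂`. Conversely, `f₀`
and `f₂` prescribe the images of the universal multimaps, and postcomposition extends them to all
multimaps (`multifunctorOfLax`). Compatibility with `∘₁` for binary maps is naturality of `f₂`, with
`∘₂` its associativity axiom, with nullary substitution its unit axioms, and with `β₃₂` its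
compatibility with `s`. Everything of higher arity follows because ternary and quaternary multimaps
are substitutions of lower ones. The compatibility with `s` comes from the one with the braiding,
since `s` is the conjugate of `1 ⊗ c` by the associator (`SkewMonoidal.s_al`). -/

/-! ### The short multicategory of a monoidal category. -/

section MonoidalMultimaps

variable {V : Type u} [Category.{v} V] [MonoidalCategory V]

/-- This and the next four lemmas are naturality squares, oriented to move structural isomorphisms
to the front. Used as rewrite rules, they bring both sides of a multicategory axiom to the form of
structural maps followed by tensor products of morphisms. The trailing map `l` is needed because
rewriting takes place inside longer composites. -/
theorem tensorHom_comp_whiskerRight_associator {a a' b b' c c' d d' : V} (f : a ⟶ a')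
    (g : b ⟶ b') (h : c ⟶ c') (k : d ⟶ d') {z : V} (l : (a' ⊗ b' ⊗ c') ⊗ d' ⟶ z) :
    (((f ⊗ₘ g) ⊗ₘ h) ⊗ₘ k) ≫ (α_ a' b' c').hom ▷ d' ≫ l =
      (α_ a b c).hom ▷ d ≫ ((f ⊗ₘ (g ⊗ₘ h)) ⊗ₘ k) ≫ l := by
  simp only [← tensorHom_id, tensorHom_comp_tensorHom_assoc, associator_naturality,
    Category.comp_id,
    Category.id_comp]

theorem tensorHom_comp_whiskerRight_rightUnitor_inv {a a' b b' z : V} (f : a ⟶ a')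
    (g : b ⟶ b') (l : (a' ⊗ 𝟙_ V) ⊗ b' ⟶ z) :
    (f ⊗ₘ g) ≫ (ρ_ a').inv ▷ b' ≫ l = (ρ_ a).inv ▷ b ≫ ((f ⊗ₘ 𝟙 _) ⊗ₘ g) ≫ l := by
  simp only [← tensorHom_id, tensorHom_comp_tensorHom_assoc, Category.comp_id, Category.id_comp]
  simp only [tensorHom_id, rightUnitor_inv_naturality]

theorem tensorHom_comp_whiskerRight_leftUnitor_inv {a a' b b' z : V} (f : a ⟶ a')
    (g : b ⟶ b') (l : (𝟙_ V ⊗ a') ⊗ b' ⟶ z) :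
    (f ⊗ₘ g) ≫ (λ_ a').inv ▷ b' ≫ l = (λ_ a).inv ▷ b ≫ ((𝟙 _ ⊗ₘ f) ⊗ₘ g) ≫ l := by
  simp only [← tensorHom_id, tensorHom_comp_tensorHom_assoc, Category.comp_id, Category.id_comp]
  simp only [id_tensorHom, leftUnitor_inv_naturality]

theorem comp_rightUnitor_inv_comp {a a' z : V} (f : a ⟶ a') (l : a' ⊗ 𝟙_ V ⟶ z) :
    f ≫ (ρ_ a').inv ≫ l = (ρ_ a).inv ≫ (f ⊗ₘ 𝟙 _) ≫ l := by
  simp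

theorem comp_leftUnitor_inv_comp {a a' z : V} (f : a ⟶ a') (l : 𝟙_ V ⊗ a' ⟶ z) :
    f ≫ (λ_ a').inv ≫ l = (λ_ a).inv ≫ (𝟙 _ ⊗ₘ f) ≫ l := by
  simp

/-- When the substituted multimap itself begins with a structural isomorphism, that isomorphism has
to be pulled out of the tensor product. The following lemmas do this for each unitor and on either
side. -/
theorem associator_comp_tensorHom {a b c d d' x : V} (f : a ⊗ b ⊗ c ⟶ x) (g : d ⟶ d') :
    ((α_ a b c).hom ≫ f) ⊗ₘ g = (α_ a b c).hom ▷ d ≫ (f ⊗ₘ g) := by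
  simp [MonoidalCategory.tensorHom_def]

theorem tensorHom_associator_comp {a b c d d' x : V} (f : a ⊗ b ⊗ c ⟶ x) (g : d ⟶ d') :
    g ⊗ₘ ((α_ a b c).hom ≫ f) = d ◁ (α_ a b c).hom ≫ (g ⊗ₘ f) := by
  simp [MonoidalCategory.tensorHom_def']

theorem tensorHom_of_rightUnitor_inv_comp {a d d' x : V} (f : a ⊗ 𝟙_ V ⟶ x) (g : d ⟶ d') :
    ((ρ_ a).inv ≫ f) ⊗ₘ g = (ρ_ a).inv ▷ d ≫ (f ⊗ₘ g) := by
  simp [MonoidalCategory.tensorHom_def]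

theorem tensorHom_of_leftUnitor_inv_comp {a d d' x : V} (f : 𝟙_ V ⊗ a ⟶ x) (g : d ⟶ d') :
    ((λ_ a).inv ≫ f) ⊗ₘ g = (λ_ a).inv ▷ d ≫ (f ⊗ₘ g) := by
  simp only [← tensorHom_id, tensorHom_comp_tensorHom, Category.id_comp]

theorem tensorHom_rightUnitor_inv_comp {a d d' x : V} (f : a ⊗ 𝟙_ V ⟶ x) (g : d ⟶ d') :
    g ⊗ₘ ((ρ_ a).inv ≫ f) = d ◁ (ρ_ a).inv ≫ (g ⊗ₘ f) := by
  simp [MonoidalCategory.tensorHom_def']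

theorem tensorHom_leftUnitor_inv_comp {a d d' x : V} (f : 𝟙_ V ⊗ a ⟶ x) (g : d ⟶ d') :
    g ⊗ₘ ((λ_ a).inv ≫ f) = d ◁ (λ_ a).inv ≫ (g ⊗ₘ f) := by
  simp [MonoidalCategory.tensorHom_def']

theorem tensorHom_comp_tensorHom_comp {a a' a'' b b' b'' z : V} (f : a ⟶ a') (g : b ⟶ b')
    (f' : a' ⟶ a'') (g' : b' ⟶ b'') (l : a'' ⊗ b'' ⟶ z) :
    (f ⊗ₘ g) ≫ (f' ⊗ₘ g') ≫ l = ((f ≫ f') ⊗ₘ (g ≫ g')) ≫ l := by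
  simp

/-- The short multicategory of a monoidal category `V`, in which an `n`-ary multimap is a morphism
out of the `n`-fold tensor product, bracketed to the left. -/
@[reducible] def shortMulticategoryOfMonoidal (V : Type u) [Category.{v} V] [MonoidalCategory V] :
    ShortMulticategory V where
  M₀ b := 𝟙_ V ⟶ b
  M₂ a₁ a₂ b := a₁ ⊗ a₂ ⟶ b
  M₃ a₁ a₂ a₃ b := (a₁ ⊗ a₂) ⊗ a₃ ⟶ b
  M₄ a₁ a₂ a₃ a₄ b := ((a₁ ⊗ a₂) ⊗ a₃) ⊗ a₄ ⟶ b
  act₀ q f := f ≫ q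
  act₂ p₁ p₂ q f := (p₁ ⊗ₘ p₂) ≫ f ≫ q
  act₃ p₁ p₂ p₃ q f := ((p₁ ⊗ₘ p₂) ⊗ₘ p₃) ≫ f ≫ q
  act₄ p₁ p₂ p₃ p₄ q f := (((p₁ ⊗ₘ p₂) ⊗ₘ p₃) ⊗ₘ p₄) ≫ f ≫ q
  sub221 {_ _ _ b₂ _} g f := (f ⊗ₘ 𝟙 b₂) ≫ g
  sub222 {a₁ a₂ b₁ _ _} g f := (α_ b₁ a₁ a₂).hom ≫ (𝟙 b₁ ⊗ₘ f) ≫ g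
  sub321 {_ _ _ b₂ b₃ _} g f := ((f ⊗ₘ 𝟙 b₂) ⊗ₘ 𝟙 b₃) ≫ g
  sub322 {a₁ a₂ b₁ _ b₃ _} g f := (α_ b₁ a₁ a₂).hom ▷ b₃ ≫ ((𝟙 b₁ ⊗ₘ f) ⊗ₘ 𝟙 b₃) ≫ g
  sub323 {a₁ a₂ b₁ b₂ _ _} g f := (α_ (b₁ ⊗ b₂) a₁ a₂).hom ≫ ((𝟙 b₁ ⊗ₘ 𝟙 b₂) ⊗ₘ f) ≫ g
  sub231 {_ _ _ _ b₂ _} g f := (f ⊗ₘ 𝟙 b₂) ≫ g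
  sub232 {a₁ a₂ a₃ b₁ _ _} g f :=
    (α_ b₁ a₁ a₂).hom ▷ a₃ ≫ (α_ b₁ (a₁ ⊗ a₂) a₃).hom ≫ (𝟙 b₁ ⊗ₘ f) ≫ g
  sub201 {_ b₂ _} g f := (λ_ b₂).inv ≫ (f ⊗ₘ 𝟙 b₂) ≫ g
  sub202 {b₁ _ _} g f := (ρ_ b₁).inv ≫ (𝟙 b₁ ⊗ₘ f) ≫ g
  sub301 {_ b₂ b₃ _} g f := (λ_ b₂).inv ▷ b₃ ≫ ((f ⊗ₘ 𝟙 b₂) ⊗ₘ 𝟙 b₃) ≫ g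
  sub302 {b₁ _ b₃ _} g f := (ρ_ b₁).inv ▷ b₃ ≫ ((𝟙 b₁ ⊗ₘ f) ⊗ₘ 𝟙 b₃) ≫ g
  sub303 {b₁ b₂ _ _} g f := (ρ_ (b₁ ⊗ b₂)).inv ≫ ((𝟙 b₁ ⊗ₘ 𝟙 b₂) ⊗ₘ f) ≫ g
  act₀_id _ := by simp
  act₂_id _ := by simp
  act₃_id _ := by simp
  act₄_id _ := by simp
  act₀_comp _ _ _ := by simp
  act₂_comp _ _ _ _ _ _ _ := by
    simp only [Category.assoc, tensorHom_comp_tensorHom_comp]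
  act₃_comp _ _ _ _ _ _ _ _ _ := by
    simp only [Category.assoc, tensorHom_comp_tensorHom_comp, tensorHom_comp_tensorHom]
  act₄_comp _ _ _ _ _ _ _ _ _ _ _ := by
    simp only [Category.assoc, tensorHom_comp_tensorHom_comp, tensorHom_comp_tensorHom]
  sub221_nat _ _ _ _ _ _ := by
    simp only [Category.assoc, tensorHom_comp_tensorHom_comp, Category.comp_id, Category.id_comp]
  sub221_dinat _ _ _ := by
    simp only [tensorHom_comp_tensorHom_comp, Category.comp_id, Category.id_comp, id_tensorHom_id]
  sub222_nat _ _ _ _ _ _ := by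
    simp only [Category.assoc, tensorHom_comp_tensorHom_comp, Category.comp_id, Category.id_comp,
      associator_naturality_assoc]
  sub222_dinat _ _ _ := by
    simp only [tensorHom_comp_tensorHom_comp, Category.comp_id, Category.id_comp, id_tensorHom_id]
  sub321_nat _ _ _ _ _ _ _ := by
    simp only [Category.assoc, tensorHom_comp_tensorHom_comp, tensorHom_comp_tensorHom,
      Category.comp_id, Category.id_comp]
  sub321_dinat _ _ _ := by
    simp only [tensorHom_comp_tensorHom_comp, tensorHom_comp_tensorHom, Category.comp_id,
      Category.id_comp, id_tensorHom_id]
  sub322_nat _ _ _ _ _ _ _ := by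
    simp only [Category.assoc, tensorHom_comp_tensorHom_comp, tensorHom_comp_tensorHom,
      Category.comp_id, Category.id_comp, tensorHom_comp_whiskerRight_associator]
  sub322_dinat _ _ _ := by
    simp only [tensorHom_comp_tensorHom_comp, tensorHom_comp_tensorHom, Category.comp_id,
      Category.id_comp, id_tensorHom_id]
  sub323_nat _ _ _ _ _ _ _ := by
    simp only [Category.assoc, tensorHom_comp_tensorHom_comp, tensorHom_comp_tensorHom,
      Category.comp_id, Category.id_comp, associator_naturality_assoc]
  sub323_dinat _ _ _ := by
    simp only [tensorHom_comp_tensorHom_comp, Category.comp_id, Category.id_comp, id_tensorHom_id]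
  sub231_nat _ _ _ _ _ _ _ := by
    simp only [Category.assoc, tensorHom_comp_tensorHom_comp, Category.comp_id, Category.id_comp]
  sub231_dinat _ _ _ := by
    simp only [tensorHom_comp_tensorHom_comp, Category.comp_id, Category.id_comp, id_tensorHom_id]
  sub232_nat _ _ _ _ _ _ _ := by
    simp only [Category.assoc, tensorHom_comp_tensorHom_comp, Category.comp_id, Category.id_comp,
      associator_naturality_assoc, tensorHom_comp_whiskerRight_associator]
  sub232_dinat _ _ _ := by
    simp only [tensorHom_comp_tensorHom_comp, Category.comp_id, Category.id_comp, id_tensorHom_id]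
  sub201_nat _ _ _ _ := by
    simp only [Category.assoc, tensorHom_comp_tensorHom_comp, Category.comp_id, Category.id_comp,
      comp_leftUnitor_inv_comp]
  sub201_dinat _ _ _ := by
    simp only [tensorHom_comp_tensorHom_comp, Category.comp_id]
  sub202_nat _ _ _ _ := by
    simp only [Category.assoc, tensorHom_comp_tensorHom_comp, Category.comp_id, Category.id_comp,
      comp_rightUnitor_inv_comp]
  sub202_dinat _ _ _ := by
    simp only [tensorHom_comp_tensorHom_comp, Category.comp_id]
  sub301_nat _ _ _ _ _ := by
    simp only [Category.assoc, tensorHom_comp_tensorHom_comp, tensorHom_comp_tensorHom,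
      Category.comp_id, Category.id_comp, tensorHom_comp_whiskerRight_leftUnitor_inv]
  sub301_dinat _ _ _ := by
    simp only [tensorHom_comp_tensorHom_comp, tensorHom_comp_tensorHom, Category.comp_id]
  sub302_nat _ _ _ _ _ := by
    simp only [Category.assoc, tensorHom_comp_tensorHom_comp, tensorHom_comp_tensorHom,
      Category.comp_id, Category.id_comp, tensorHom_comp_whiskerRight_rightUnitor_inv]
  sub302_dinat _ _ _ := by
    simp only [tensorHom_comp_tensorHom_comp, tensorHom_comp_tensorHom, Category.comp_id]
  sub303_nat _ _ _ _ _ := by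
    simp only [Category.assoc, tensorHom_comp_tensorHom_comp, tensorHom_comp_tensorHom,
      Category.comp_id, Category.id_comp, comp_rightUnitor_inv_comp]
  sub303_dinat _ _ _ := by
    simp only [tensorHom_comp_tensorHom_comp, tensorHom_comp_tensorHom, Category.comp_id]
  assoc2_11 _ _ _ := by
    simp only [tensorHom_comp_tensorHom_comp, Category.comp_id]
  assoc2_12 _ _ _ := by
    simp only [Category.assoc, tensorHom_comp_tensorHom_comp, Category.comp_id,
      associator_comp_tensorHom]
  assoc2_21 _ _ _ := by
    simp only [tensorHom_comp_tensorHom_comp, Category.comp_id, associator_naturality_assoc]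
  -- The pentagon enters here: both substitutions take place in the last input, so all four objects
  -- are rebracketed to the right.
  assoc2_22 {_ _ b _ d _ _} _ _ _ := by
    simp only [Category.assoc, tensorHom_comp_tensorHom_comp, Category.comp_id,
      associator_naturality_assoc, tensorHom_associator_comp, pentagon_assoc]
  assoc0_11 _ _ _ := by
    simp only [Category.assoc, tensorHom_comp_tensorHom_comp, Category.comp_id,
      tensorHom_of_leftUnitor_inv_comp]
  assoc0_12 _ _ _ := by
    simp only [Category.assoc, tensorHom_comp_tensorHom_comp, Category.comp_id,
      tensorHom_of_rightUnitor_inv_comp]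
  -- After normalisation the triangle identity is left over, for the unit in the middle.
  assoc0_21 _ _ _ := by
    simp only [Category.assoc, tensorHom_comp_tensorHom_comp, Category.comp_id,
      associator_naturality_assoc, tensorHom_leftUnitor_inv_comp]
    simp
  assoc0_22 _ _ _ := by
    simp only [Category.assoc, tensorHom_comp_tensorHom_comp, Category.comp_id,
      associator_naturality_assoc, tensorHom_rightUnitor_inv_comp]
    simp
  comm_22 _ _ _ := by
    simp only [tensorHom_comp_tensorHom_comp, Category.comp_id, Category.id_comp,
      associator_naturality_assoc, id_tensorHom_id]
  comm_20 _ _ _ := by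
    simp only [tensorHom_comp_tensorHom_comp, Category.comp_id, Category.id_comp,
      comp_rightUnitor_inv_comp, id_tensorHom_id]
  comm_02 _ _ _ := by
    simp only [tensorHom_comp_tensorHom_comp, Category.comp_id, Category.id_comp,
      associator_naturality_assoc, comp_leftUnitor_inv_comp, id_tensorHom_id]
    simp
  -- This amounts to the agreement of the left and right unitors at the unit object.
  comm_00 _ _ _ := by
    simp only [tensorHom_comp_tensorHom_comp, comp_rightUnitor_inv_comp, comp_leftUnitor_inv_comp,
      Category.comp_id, Category.id_comp, unitors_inv_equal]

end MonoidalMultimaps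

/-! ### The short braiding of a braided monoidal category. -/

section BraidedMultimaps

variable {V : Type u} [Category.{v} V] [MonoidalCategory V] [BraidedCategory V]

/-- The isomorphism `(xa)b ≅ (xb)a` of a braided monoidal category which interchanges the last two
factors. -/
def swapLast (x a b : V) : (x ⊗ a) ⊗ b ≅ (x ⊗ b) ⊗ a :=
  α_ x a b ≪≫ whiskerLeftIso x (β_ a b) ≪≫ (α_ x b a).symm

theorem swapLast_hom (x a b : V) :
    (swapLast x a b).hom = (α_ x a b).hom ≫ x ◁ (β_ a b).hom ≫ (α_ x b a).inv := rfl

theorem swapLast_naturality {x x' a a' b b' : V} (f : x ⟶ x') (g : a ⟶ a') (h : b ⟶ b') :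
    ((f ⊗ₘ g) ⊗ₘ h) ≫ (swapLast x' a' b').hom =
      (swapLast x a b).hom ≫ ((f ⊗ₘ h) ⊗ₘ g) := by
  have : (f ⊗ₘ (g ⊗ₘ h)) ≫ x' ◁ (β_ a' b').hom = x ◁ (β_ a b).hom ≫ (f ⊗ₘ (h ⊗ₘ g)) := by
    rw [← id_tensorHom, ← id_tensorHom, tensorHom_comp_tensorHom, tensorHom_comp_tensorHom,
      BraidedCategory.braiding_naturality, Category.comp_id, Category.id_comp]
  rw [swapLast_hom, associator_naturality_assoc, reassoc_of% this, swapLast_hom]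
  simp only [Category.assoc, associator_inv_naturality]

theorem swapLast_naturality_assoc {x x' a a' b b' z : V} (f : x ⟶ x') (g : a ⟶ a') (h : b ⟶ b')
    (l : (x' ⊗ b') ⊗ a' ⟶ z) :
    ((f ⊗ₘ g) ⊗ₘ h) ≫ (swapLast x' a' b').hom ≫ l =
      (swapLast x a b).hom ≫ ((f ⊗ₘ h) ⊗ₘ g) ≫ l := by
  rw [← Category.assoc, swapLast_naturality, Category.assoc]

theorem swapLast_symm (h : ∀ a b : V, (β_ a b).hom ≫ (β_ b a).hom = 𝟙 (a ⊗ b)) (x a b : V) :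
    (swapLast x a b).hom ≫ (swapLast x b a).hom = 𝟙 _ := by
  simp [swapLast_hom, ← whiskerLeft_comp_assoc, h]

/-- Up to coherence, this is the Yang–Baxter equation for `a`, `b`, `c` with `x` standing inert on
the left. -/
theorem swapLast_yang_baxter (x a b c : V) :
    (swapLast (x ⊗ a) b c).hom ≫ (swapLast x a c).hom ▷ b ≫ (swapLast (x ⊗ c) a b).hom =
      (swapLast x a b).hom ▷ c ≫ (swapLast (x ⊗ b) a c).hom ≫ (swapLast x b c).hom ▷ a := by
  -- The outer associators carry left-bracketed fourfold products to `x ⊗ (a ⊗ (b ⊗ c))` and back.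
  -- The library's equation has its two sides in the opposite order, hence `this.symm` below.
  have := congrArg (fun t ↦ (α_ (x ⊗ a) b c).hom ≫ (α_ x a (b ⊗ c)).hom ≫ x ◁ t ≫
    (α_ x c (b ⊗ a)).inv ≫ (α_ (x ⊗ c) b a).inv) (BraidedCategory.yang_baxter a b c)
  refine Eq.trans ?_ (this.symm.trans ?_) <;> simp only [swapLast_hom] <;> monoidal

/-- This is one hexagon whiskered by `x`, and `swapLast_tensor_left` is the other; they give the
axioms for `β₃₂` of a ternary multimap with a binary one substituted into its second or third input.
-/
theorem swapLast_tensor_right (x a b c : V) :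
    (swapLast x a b).hom ▷ c ≫ (swapLast (x ⊗ b) a c).hom ≫ (α_ x b c).hom ▷ a =
      (α_ (x ⊗ a) b c).hom ≫ (swapLast x a (b ⊗ c)).hom := by
  simp only [swapLast_hom, BraidedCategory.braiding_tensor_right_hom]
  monoidal

theorem swapLast_tensor_left (x a b c : V) :
    (swapLast (x ⊗ a) b c).hom ≫ (swapLast x a c).hom ▷ b ≫ (α_ (x ⊗ c) a b).hom =
      (α_ x a b).hom ▷ c ≫ (swapLast x (a ⊗ b) c).hom := by
  simp only [swapLast_hom, BraidedCategory.braiding_tensor_left_hom]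
  monoidal

/-- Both sides contain the single braiding of `b` with `c`, so coherence for monoidal categories
suffices. -/
theorem associator_swapLast (x a b c : V) :
    (α_ x a b).hom ▷ c ≫ (α_ x (a ⊗ b) c).hom ≫ x ◁ (swapLast a b c).hom =
      (swapLast (x ⊗ a) b c).hom ≫ (α_ x a c).hom ▷ b ≫ (α_ x (a ⊗ c) b).hom := by
  simp only [swapLast_hom]
  monoidal

/-- The short braiding of the short multicategory of a braided monoidal category. -/
@[reducible] def shortBraidingOfBraided (V : Type u) [Category.{v} V] [MonoidalCategory V]
    [BraidedCategory V] :
    letI := shortMulticategoryOfMonoidal V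
    ShortBraiding V :=
  letI := shortMulticategoryOfMonoidal V
  -- Precomposition reverses direction: the new multimap starts at `(a₁ ⊗ a₃) ⊗ a₂`, so the map to
  -- use is `swapLast a₁ a₃ a₂`. This agrees with the convention `s ∘ (θ ∘₁ θ) = β₃₂ (θ ∘₁ θ)`.
  { β₃₂ := fun {a₁ a₂ a₃ b} ↦
      (⟨fun f ↦ (swapLast a₁ a₃ a₂).hom ≫ f, fun f ↦ (swapLast a₁ a₃ a₂).inv ≫ f,
        fun _ ↦ by simp, fun _ ↦ by simp⟩ :
        ((a₁ ⊗ a₂) ⊗ a₃ ⟶ b) ≃ ((a₁ ⊗ a₃) ⊗ a₂ ⟶ b))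
    β₄₂ := fun {a₁ a₂ a₃ a₄ b} ↦
      (⟨fun f ↦ (swapLast a₁ a₃ a₂).hom ▷ a₄ ≫ f, fun f ↦ (swapLast a₁ a₃ a₂).inv ▷ a₄ ≫ f,
        fun _ ↦ by simp, fun _ ↦ by simp⟩ :
        (((a₁ ⊗ a₂) ⊗ a₃) ⊗ a₄ ⟶ b) ≃ (((a₁ ⊗ a₃) ⊗ a₂) ⊗ a₄ ⟶ b))
    β₄₃ := fun {a₁ a₂ a₃ a₄ b} ↦
      (⟨fun f ↦ (swapLast (a₁ ⊗ a₂) a₄ a₃).hom ≫ f, fun f ↦ (swapLast (a₁ ⊗ a₂) a₄ a₃).inv ≫ f,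
        fun _ ↦ by simp, fun _ ↦ by simp⟩ :
        (((a₁ ⊗ a₂) ⊗ a₃) ⊗ a₄ ⟶ b) ≃ (((a₁ ⊗ a₂) ⊗ a₄) ⊗ a₃ ⟶ b))
    β₃₂_nat := fun {a₁ a₁' a₂ a₂' a₃ a₃' b b'} p₁ p₂ p₃ q (f : (a₁ ⊗ a₂) ⊗ a₃ ⟶ b) ↦ by
      change (swapLast a₁' a₃' a₂').hom ≫ ((p₁ ⊗ₘ p₂) ⊗ₘ p₃) ≫ f ≫ q =
        ((p₁ ⊗ₘ p₃) ⊗ₘ p₂) ≫ ((swapLast a₁ a₃ a₂).hom ≫ f) ≫ q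
      rw [Category.assoc, swapLast_naturality_assoc]
    β₄₂_nat := fun {a₁ a₁' a₂ a₂' a₃ a₃' a₄ a₄' b b'} p₁ p₂ p₃ p₄ q
        (f : ((a₁ ⊗ a₂) ⊗ a₃) ⊗ a₄ ⟶ b) ↦ by
      change (swapLast a₁' a₃' a₂').hom ▷ a₄' ≫ (((p₁ ⊗ₘ p₂) ⊗ₘ p₃) ⊗ₘ p₄) ≫ f ≫ q =
        (((p₁ ⊗ₘ p₃) ⊗ₘ p₂) ⊗ₘ p₄) ≫ ((swapLast a₁ a₃ a₂).hom ▷ a₄ ≫ f) ≫ q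
      simp only [← tensorHom_id, Category.assoc, tensorHom_comp_tensorHom_comp,
        swapLast_naturality, Category.comp_id, Category.id_comp]
    β₄₃_nat := fun {a₁ a₁' a₂ a₂' a₃ a₃' a₄ a₄' b b'} p₁ p₂ p₃ p₄ q
        (f : ((a₁ ⊗ a₂) ⊗ a₃) ⊗ a₄ ⟶ b) ↦ by
      change (swapLast (a₁' ⊗ a₂') a₄' a₃').hom ≫ (((p₁ ⊗ₘ p₂) ⊗ₘ p₃) ⊗ₘ p₄) ≫ f ≫ q =
        (((p₁ ⊗ₘ p₂) ⊗ₘ p₄) ⊗ₘ p₃) ≫ ((swapLast (a₁ ⊗ a₂) a₄ a₃).hom ≫ f) ≫ q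
      rw [Category.assoc, swapLast_naturality_assoc]
    yang_baxter := fun {a₁ a₂ a₃ a₄ b} (h : ((a₁ ⊗ a₂) ⊗ a₃) ⊗ a₄ ⟶ b) ↦ by
      change (swapLast a₁ a₄ a₃).hom ▷ a₂ ≫ (swapLast (a₁ ⊗ a₃) a₄ a₂).hom ≫
          (swapLast a₁ a₃ a₂).hom ▷ a₄ ≫ h =
        (swapLast (a₁ ⊗ a₄) a₃ a₂).hom ≫ (swapLast a₁ a₄ a₂).hom ▷ a₃ ≫
          (swapLast (a₁ ⊗ a₂) a₄ a₃).hom ≫ h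
      rw [← reassoc_of% (swapLast_yang_baxter a₁ a₄ a₃ a₂)]
    sub231_β₃₂ := fun {a₁ a₂ a₃ b₁ b₂ c} (g : b₁ ⊗ b₂ ⟶ c) (f : (a₁ ⊗ a₂) ⊗ a₃ ⟶ b₁) ↦ by
      change ((swapLast a₁ a₃ a₂).hom ≫ f ⊗ₘ 𝟙 b₂) ≫ g =
        (swapLast a₁ a₃ a₂).hom ▷ b₂ ≫ (f ⊗ₘ 𝟙 b₂) ≫ g
      simp
    sub232_β₃₂ := fun {a₁ a₂ a₃ b₁ b₂ c} (g : b₁ ⊗ b₂ ⟶ c) (f : (a₁ ⊗ a₂) ⊗ a₃ ⟶ b₂) ↦ by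
      change (α_ b₁ a₁ a₃).hom ▷ a₂ ≫ (α_ b₁ (a₁ ⊗ a₃) a₂).hom ≫
          (𝟙 b₁ ⊗ₘ (swapLast a₁ a₃ a₂).hom ≫ f) ≫ g =
        (swapLast (b₁ ⊗ a₁) a₃ a₂).hom ≫ (α_ b₁ a₁ a₂).hom ▷ a₃ ≫ (α_ b₁ (a₁ ⊗ a₂) a₃).hom ≫
          (𝟙 b₁ ⊗ₘ f) ≫ g
      rw [← reassoc_of% (associator_swapLast b₁ a₁ a₃ a₂)]
      simp
    β₄₃_sub321 := fun {a₁ a₂ b₁ b₂ b₃ c} (g : (b₁ ⊗ b₂) ⊗ b₃ ⟶ c) (f : a₁ ⊗ a₂ ⟶ b₁) ↦ by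
      change (swapLast (a₁ ⊗ a₂) b₃ b₂).hom ≫ ((f ⊗ₘ 𝟙 b₂) ⊗ₘ 𝟙 b₃) ≫ g =
        ((f ⊗ₘ 𝟙 b₃) ⊗ₘ 𝟙 b₂) ≫ (swapLast b₁ b₃ b₂).hom ≫ g
      rw [swapLast_naturality_assoc]
    β₄₂_β₄₃_sub322 := fun {a₁ a₂ b₁ b₂ b₃ c} (g : (b₁ ⊗ b₂) ⊗ b₃ ⟶ c) (f : a₁ ⊗ a₂ ⟶ b₂) ↦ by
      change (swapLast b₁ b₃ a₁).hom ▷ a₂ ≫ (swapLast (b₁ ⊗ a₁) b₃ a₂).hom ≫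
          (α_ b₁ a₁ a₂).hom ▷ b₃ ≫ ((𝟙 b₁ ⊗ₘ f) ⊗ₘ 𝟙 b₃) ≫ g =
        (α_ (b₁ ⊗ b₃) a₁ a₂).hom ≫ ((𝟙 b₁ ⊗ₘ 𝟙 b₃) ⊗ₘ f) ≫ (swapLast b₁ b₃ b₂).hom ≫ g
      rw [swapLast_naturality_assoc, reassoc_of% (swapLast_tensor_right b₁ b₃ a₁ a₂)]
    β₄₃_β₄₂_sub323 := fun {a₁ a₂ b₁ b₂ b₃ c} (g : (b₁ ⊗ b₂) ⊗ b₃ ⟶ c) (f : a₁ ⊗ a₂ ⟶ b₃) ↦ by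
      change (swapLast (b₁ ⊗ a₁) a₂ b₂).hom ≫ (swapLast b₁ a₁ b₂).hom ▷ a₂ ≫
          (α_ (b₁ ⊗ b₂) a₁ a₂).hom ≫ ((𝟙 b₁ ⊗ₘ 𝟙 b₂) ⊗ₘ f) ≫ g =
        (α_ b₁ a₁ a₂).hom ▷ b₂ ≫ ((𝟙 b₁ ⊗ₘ f) ⊗ₘ 𝟙 b₂) ≫ (swapLast b₁ b₃ b₂).hom ≫ g
      rw [swapLast_naturality_assoc, reassoc_of% (swapLast_tensor_left b₁ a₁ a₂ b₂)] }

theorem isShortSymmetry_shortBraidingOfBraided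
    (h : ∀ a b : V, (β_ a b).hom ≫ (β_ b a).hom = 𝟙 (a ⊗ b)) :
    letI := shortMulticategoryOfMonoidal V
    letI := shortBraidingOfBraided V
    IsShortSymmetry V := by
  intro a₁ a₂ a₃ _ f
  exact (reassoc_of% (swapLast_symm h a₁ a₂ a₃)) f

end BraidedMultimaps

/-! ### Left representability, and the isomorphism of `K` of the multicategory with `V`. -/

theorem bijective_comp_of_isIso {V : Type u} [Category.{v} V] {a b : V} (e : a ⟶ b) [IsIso e]
    (d : V) : Function.Bijective fun f : b ⟶ d ↦ e ≫ f :=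
  (asIso e).symm.homFromEquiv.bijective

/-- With identities as universal multimaps, each substitution map is precomposition with an
isomorphism assembled from unitors and identities. -/
theorem leftRepresentable_shortMulticategoryOfMonoidal (V : Type u) [Category.{v} V]
    [MonoidalCategory V] :
    letI := shortMulticategoryOfMonoidal V
    LeftRepresentable V :=
  letI := shortMulticategoryOfMonoidal V
  { nullary := ⟨𝟙_ V, 𝟙 (𝟙_ V),
      { bijective₀ := fun b ↦ by
          change Function.Bijective fun f : 𝟙_ V ⟶ b ↦ 𝟙 (𝟙_ V) ≫ f
          exact bijective_comp_of_isIso _ _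
        bijective₁ := fun x d ↦ by
          change Function.Bijective fun f : 𝟙_ V ⊗ x ⟶ d ↦ (λ_ x).inv ≫ (𝟙 (𝟙_ V) ⊗ₘ 𝟙 x) ≫ f
          simp only [← Category.assoc]
          exact bijective_comp_of_isIso _ _
        bijective₂ := fun x y d ↦ by
          change Function.Bijective fun f : (𝟙_ V ⊗ x) ⊗ y ⟶ d ↦
            (λ_ x).inv ▷ y ≫ ((𝟙 (𝟙_ V) ⊗ₘ 𝟙 x) ⊗ₘ 𝟙 y) ≫ f
          simp only [← Category.assoc]
          exact bijective_comp_of_isIso _ _ }⟩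
    binary := fun a b ↦ ⟨a ⊗ b, 𝟙 (a ⊗ b),
      { bijective₂ := fun d ↦ by
          change Function.Bijective fun f : a ⊗ b ⟶ d ↦ (𝟙 a ⊗ₘ 𝟙 b) ≫ 𝟙 (a ⊗ b) ≫ f
          simp only [← Category.assoc]
          exact bijective_comp_of_isIso _ _
        bijective₃ := fun x d ↦ by
          change Function.Bijective fun f : (a ⊗ b) ⊗ x ⟶ d ↦ (𝟙 (a ⊗ b) ⊗ₘ 𝟙 x) ≫ f
          exact bijective_comp_of_isIso _ _
        bijective₄ := fun x y d ↦ by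
          change Function.Bijective fun f : ((a ⊗ b) ⊗ x) ⊗ y ⟶ d ↦
            ((𝟙 (a ⊗ b) ⊗ₘ 𝟙 x) ⊗ₘ 𝟙 y) ≫ f
          exact bijective_comp_of_isIso _ _ }⟩ }

/-- This Yoneda argument makes any universal multimap invertible, in particular the ones chosen in
`un` and `th`, about which nothing else is known. -/
theorem isIso_of_bijective_comp {V : Type u} [Category.{v} V] {a b : V} (e : a ⟶ b)
    (h : ∀ d : V, Function.Bijective fun f : b ⟶ d ↦ e ≫ f) : IsIso e := by
  obtain ⟨t, ht⟩ := (h a).surjective (𝟙 a)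
  refine ⟨t, ht, (h b).injective ?_⟩
  rw [reassoc_of% (show e ≫ t = 𝟙 a from ht), Category.comp_id]

namespace MonoidalMultimaps

variable {V : Type u} [Category.{v} V] [MonoidalCategory V]

attribute [local instance] shortMulticategoryOfMonoidal
  leftRepresentable_shortMulticategoryOfMonoidal

variable (V) in
/-- The universal nullary multimap, as a morphism. -/
noncomputable def unHom : 𝟙_ V ⟶ unit V := un V

/-- The universal binary multimap, as a morphism. -/
noncomputable def thHom (a b : V) : a ⊗ b ⟶ tens a b := th a b

instance : IsIso (unHom V) :=
  isIso_of_bijective_comp _ un_universal.bijective₀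

/-- A dictionary: equations about universal multimaps proved for general left representable
multicategories become equations between morphisms of `V`. `thHom_comp₃` does the same for ternary
multimaps. -/
theorem thHom_comp {a b c : V} (f : tens a b ⟶ c) :
    thHom a b ≫ f = (post₂ f (th a b) : M₂ a b c) := by
  change _ = (𝟙 a ⊗ₘ 𝟙 b) ≫ thHom a b ≫ f
  simp

instance (a b : V) : IsIso (thHom a b) :=
  isIso_of_bijective_comp _ fun d ↦ by
    simpa only [thHom_comp] using (th_universal a b).bijective₂ d

theorem thHom_tensHom {a a' b b' : V} (f : a ⟶ a') (g : b ⟶ b') :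
    thHom a b ≫ tensHom f g = (f ⊗ₘ g) ≫ thHom a' b' := by
  rw [thHom_comp, post_tensHom]
  change (f ⊗ₘ g) ≫ thHom a' b' ≫ 𝟙 _ = _
  simp

theorem thHom_comp₃ {a b c d : V} (f : tens (tens a b) c ⟶ d) :
    thHom a b ▷ c ≫ thHom (tens a b) c ≫ f = (post₃ f (th₃ a b c) : M₃ a b c d) := by
  change _ = ((𝟙 a ⊗ₘ 𝟙 b) ⊗ₘ 𝟙 c) ≫ ((thHom a b ⊗ₘ 𝟙 c) ≫ thHom (tens a b) c) ≫ f
  simp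

/-- The defining equation of `assoc`, read in `V`; it is the associativity axiom for the identity
functor with comparison `thHom`. The unit lemmas below serve likewise. -/
theorem thHom_assoc (a b c : V) : thHom a b ▷ c ≫ thHom (tens a b) c ≫ assoc a b c =
    (α_ a b c).hom ≫ a ◁ thHom b c ≫ thHom a (tens b c) := by
  rw [thHom_comp₃, post_assoc]
  change (α_ a b c).hom ≫ (𝟙 a ⊗ₘ thHom b c) ≫ thHom a (tens b c) = _
  simp

theorem thHom_leftUnit (a : V) : unHom V ▷ a ≫ thHom (unit V) a ≫ leftUnit a = (λ_ a).hom := by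
  have h : ((λ_ a).inv ≫ (unHom V ⊗ₘ 𝟙 a) ≫ thHom (unit V) a) ≫ leftUnit a = 𝟙 a := th_leftUnit a
  rw [← cancel_epi (λ_ a).inv]
  simpa using h

theorem rightUnit_eq (a : V) : rightUnit a = (ρ_ a).inv ≫ a ◁ unHom V ≫ thHom a (unit V) := by
  rw [← id_tensorHom]; rfl

end MonoidalMultimaps

namespace MonoidalMultimaps

variable {V : Type u} [Category.{v} V] [MonoidalCategory V] [BraidedCategory V]

attribute [local instance] shortMulticategoryOfMonoidal
  leftRepresentable_shortMulticategoryOfMonoidal shortBraidingOfBraided skewMonoidal skewBraiding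
  leftNormal

theorem thHom_sw (x a b : V) : thHom x a ▷ b ≫ thHom (tens x a) b ≫ sw x a b =
    (swapLast x a b).hom ≫ thHom x b ▷ a ≫ thHom (tens x b) a := by
  rw [thHom_comp₃, post_sw]
  change (swapLast x a b).hom ≫ (thHom x b ⊗ₘ 𝟙 a) ≫ thHom (tens x b) a = _
  simp

/-- The braiding of `K` is obtained from `sw` at the chosen unit by conjugating with left unit maps.
Transporting along `unHom` replaces that unit by `𝟙_ V`, where `swapLast` reduces to `β` up to left
unitors. -/
theorem thHom_swap (a b : V) :
    thHom a b ≫ (SkewMonoidal.swap a b : tens a b ⟶ tens b a) = (β_ a b).hom ≫ thHom b a := by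
  have hl (a b : V) : (unHom V ▷ a) ▷ b ≫ thHom (unit V) a ▷ b ≫ thHom (tens (unit V) a) b ≫
      tensHom (leftUnit a) (𝟙 b) = (λ_ a).hom ▷ b ≫ thHom a b := by
    rw [thHom_tensHom, ← thHom_leftUnit]
    simp
  have hs : tensHom (leftUnit a) (𝟙 b) ≫ (SkewMonoidal.swap a b : tens a b ⟶ tens b a) =
    sw (unit V) a b ≫ tensHom (leftUnit b) (𝟙 a) := SkewMonoidal.lam_swap a b
  have hn {z : V} (l : (unit V ⊗ b) ⊗ a ⟶ z) : (unHom V ▷ a) ▷ b ≫ (swapLast (unit V) a b).hom ≫ l =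
      (swapLast (𝟙_ V) a b).hom ≫ (unHom V ▷ b) ▷ a ≫ l := by
    simpa only [tensorHom_id] using swapLast_naturality_assoc (unHom V) (𝟙 a) (𝟙 b) l
  have ht : (swapLast (𝟙_ V) a b).hom ≫ (λ_ b).hom ▷ a = (λ_ a).hom ▷ b ≫ (β_ a b).hom := by
    simp [swapLast_hom]
  rw [← cancel_epi ((λ_ a).hom ▷ b), ← reassoc_of% hl, hs, reassoc_of% thHom_sw]
  rw [hn, hl, reassoc_of% ht]

/-- Left representability alone gives only a skew monoidal structure; invertibility of the right
unit map is a consequence of the braiding. It is needed because the right unitor of `K` is its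
inverse. -/
theorem isIso_rightUnit (a : V) : IsIso (rightUnit a) := SkewMonoidal.isIso_rh a

attribute [local instance] isIso_rightUnit

theorem thHom_inv_rightUnit (a : V) :
    a ◁ unHom V ≫ thHom a (unit V) ≫ inv (rightUnit a) = (ρ_ a).hom := by
  rw [← Category.assoc, IsIso.comp_inv_eq, rightUnit_eq]
  simp

variable (V)

/-- The comparison from `K` of the short multicategory of `V` to `V`. -/
noncomputable def comparisonHom : kBrdObj V ⟶ (⟨V⟩ : BrdMonCat.{v, u}) where
  toFunctor := 𝟭 V
  laxBraided :=
    { ε := unHom V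
      μ := fun (a b : V) ↦ thHom a b
      μ_natural_left := fun {a a' : V} (f : a ⟶ a') (b : V) ↦ by
        change f ▷ b ≫ thHom a' b = thHom a b ≫ tensHom f (𝟙 b)
        rw [thHom_tensHom, tensorHom_id]
      μ_natural_right := fun {a a' : V} (b : V) (f : a ⟶ a') ↦ by
        change b ◁ f ≫ thHom b a' = thHom b a ≫ tensHom (𝟙 b) f
        rw [thHom_tensHom, id_tensorHom]
      associativity := thHom_assoc (V := V)
      left_unitality := fun (a : V) ↦ (thHom_leftUnit a).symm
      right_unitality := fun (a : V) ↦ (thHom_inv_rightUnit a).symm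
      braided := thHom_swap (V := V) }

/-- The comparison from `V` to `K` of the short multicategory of `V`. -/
noncomputable def comparisonInv : (⟨V⟩ : BrdMonCat.{v, u}) ⟶ kBrdObj V where
  toFunctor := 𝟭 V
  laxBraided :=
    { ε := (inv (unHom V) : unit V ⟶ 𝟙_ V)
      μ := fun (a b : V) ↦ (inv (thHom a b) : tens a b ⟶ a ⊗ b)
      μ_natural_left := fun {a a' : V} (f : a ⟶ a') (b : V) ↦ by
        change tensHom f (𝟙 b) ≫ inv (thHom a' b) = inv (thHom a b) ≫ f ▷ b
        rw [IsIso.comp_inv_eq, Category.assoc, IsIso.eq_inv_comp, thHom_tensHom, tensorHom_id]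
      μ_natural_right := fun {a a' : V} (b : V) (f : a ⟶ a') ↦ by
        change tensHom (𝟙 b) f ≫ inv (thHom b a') = inv (thHom b a) ≫ b ◁ f
        rw [IsIso.comp_inv_eq, Category.assoc, IsIso.eq_inv_comp, thHom_tensHom, id_tensorHom]
      associativity := fun (a b c : V) ↦ by
        change tensHom (inv (thHom a b)) (𝟙 c) ≫ inv (thHom (a ⊗ b) c) ≫ (α_ a b c).hom =
          assoc a b c ≫ tensHom (𝟙 a) (inv (thHom b c)) ≫ inv (thHom a (b ⊗ c))
        -- Precomposing with these isomorphisms gives the source `(a ⊗ b) ⊗ c`, where `thHom_assoc`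
        -- and `thHom_tensHom` express the chosen structure through that of `V`.
        rw [← cancel_epi (thHom (tens a b) c), ← cancel_epi (thHom a b ▷ c),
          reassoc_of% (thHom_assoc a b c), reassoc_of% (thHom_tensHom (inv (thHom a b)) (𝟙 c)),
          reassoc_of% (thHom_tensHom (𝟙 a) (inv (thHom b c)))]
        simp
      left_unitality := fun (a : V) ↦ by
        change leftUnit a = tensHom (inv (unHom V)) (𝟙 a) ≫ inv (thHom (𝟙_ V) a) ≫ (λ_ a).hom
        rw [← cancel_epi (thHom (unit V) a), ← cancel_epi (unHom V ▷ a), thHom_leftUnit,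
          reassoc_of% (thHom_tensHom (inv (unHom V)) (𝟙 a))]
        simp
      right_unitality := fun (a : V) ↦ by
        change inv (rightUnit a) = tensHom (𝟙 a) (inv (unHom V)) ≫ inv (thHom a (𝟙_ V)) ≫
          (ρ_ a).hom
        rw [← cancel_epi (thHom a (unit V)), ← cancel_epi (a ◁ unHom V), thHom_inv_rightUnit,
          reassoc_of% (thHom_tensHom (𝟙 a) (inv (unHom V)))]
        simp
      braided := fun (a b : V) ↦ by
        change inv (thHom a b) ≫ (β_ a b).hom =
          (SkewMonoidal.swap a b : tens a b ⟶ tens b a) ≫ inv (thHom b a)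
        rw [IsIso.inv_comp_eq, reassoc_of% (thHom_swap a b), IsIso.hom_inv_id, Category.comp_id] }

/-- Every braided monoidal category is isomorphic to `K` of its short multicategory. -/
noncomputable def comparisonIso : kBrdObj V ≅ (⟨V⟩ : BrdMonCat.{v, u}) where
  hom := comparisonHom V
  inv := comparisonInv V
  hom_inv_id := by
    -- The underlying functor is the identity, so only the unit and tensor comparisons of the
    -- composite remain, and these are an inverse followed by the original map.
    refine BrdMonCat.laxBraidedFunctor_eq (C := (kBrdObj V).carrier) _ _
      (LaxBraidedFunctor.laxBraided (𝟙 (kBrdObj V))) rfl ?_ ?_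
    · exact (IsIso.inv_hom_id (unHom V))
    · exact fun (a b : V) ↦ IsIso.inv_hom_id (thHom a b)
  inv_hom_id := by
    refine BrdMonCat.laxBraidedFunctor_eq (C := V) _ _
      (LaxBraidedFunctor.laxBraided (𝟙 (⟨V⟩ : BrdMonCat.{v, u}))) rfl ?_ ?_
    · exact (IsIso.hom_inv_id (unHom V))
    · exact fun (a b : V) ↦ IsIso.hom_inv_id (thHom a b)

end MonoidalMultimaps

/-! ### From braided lax monoidal functors back to the skew structure. -/

namespace SkewMonoidal

variable {C : Type u₁} [Category.{v₁} C] [SkewMonoidal C] [Braiding C] [LeftNormal C]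
  {D : Type u₂} [Category.{v₂} D] [SkewMonoidal D] [Braiding D] [LeftNormal D]

/-- A braided lax monoidal functor between the braided monoidal categories associated with left
normal braided skew monoidal categories is a braided lax monoidal functor between the latter. -/
@[reducible] def LaxBraided.ofFunctorLaxBraided (F : C ⥤ D)
    (L : letI := monoidalCategory C
      letI := braidedCategory C
      letI := monoidalCategory D
      letI := braidedCategory D
      F.LaxBraided) : LaxBraided F :=
  letI := monoidalCategory C
  letI := braidedCategory C
  letI := monoidalCategory D
  letI := braidedCategory D
  have f₂_nat {a a' b b' : C} (g : a ⟶ a') (h : b ⟶ b') :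
      tenHom (F.map g) (F.map h) ≫ L.μ a' b' = L.μ a b ≫ F.map (tenHom g h) := by
    have h₁ : tenHom (F.map g) (𝟙 _) ≫ L.μ a' b = L.μ a b ≫ F.map (tenHom g (𝟙 b)) :=
      L.μ_natural_left g b
    have h₂ : tenHom (𝟙 _) (F.map h) ≫ L.μ a' b' = L.μ a' b ≫ F.map (tenHom (𝟙 a') h) :=
      L.μ_natural_right a' h
    -- Lax naturality is given one variable at a time; this factorisation combines the two halves.
    have h₃ : tenHom (F.map g) (F.map h) = tenHom (F.map g) (𝟙 _) ≫ tenHom (𝟙 _) (F.map h) := by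
      simp [tenHom_comp]
    rw [h₃, Category.assoc, h₂, reassoc_of% h₁, ← F.map_comp, tenHom_comp, Category.comp_id,
      Category.id_comp]
  have f₂_al (a b c : C) : tenHom (L.μ a b) (𝟙 (F.obj c)) ≫ L.μ (ten a b) c ≫ F.map (al a b c) =
      al (F.obj a) (F.obj b) (F.obj c) ≫ tenHom (𝟙 (F.obj a)) (L.μ b c) ≫ L.μ a (ten b c) :=
    L.associativity a b c
  { f₀ := L.ε
    f₂ := L.μ
    f₂_nat := f₂_nat
    f₂_al := f₂_al
    f₂_lam := fun a ↦ (L.left_unitality a).symm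
    f₂_rh := fun a ↦ by
      have h : inv (rh (F.obj a)) = tenHom (𝟙 (F.obj a)) L.ε ≫ L.μ a one ≫ F.map (inv (rh a)) :=
        L.right_unitality a
      change rh (F.obj a) ≫ tenHom (𝟙 (F.obj a)) L.ε ≫ L.μ a one = F.map (rh a)
      -- The right unitor of the monoidal category is the inverse of `rh`, so the right unit axiom
      -- has to be inverted on both sides.
      rw [← cancel_mono (F.map (inv (rh a)))]
      simp only [Category.assoc]
      rw [← h, IsIso.hom_inv_id, ← F.map_comp, IsIso.hom_inv_id, F.map_id]
    f₂_s := fun x a b ↦ by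
      have h : L.μ a b ≫ F.map (swap a b) = swap (F.obj a) (F.obj b) ≫ L.μ b a := L.braided a b
      have hn := f₂_nat (𝟙 x) (swap a b)
      rw [F.map_id] at hn
      -- After composition with the invertible associator, `s_al` turns both occurrences of `s` into
      -- `1 ⊗ swap`, to which the braiding axiom `h` applies.
      rw [← cancel_mono (F.map (al x b a))]
      simp only [Category.assoc]
      rw [f₂_al, reassoc_of% (s_al (F.obj x)), ← F.map_comp, s_al, F.map_comp,
        reassoc_of% (f₂_al x a b), ← hn, tenHom_comp_assoc, tenHom_comp_assoc, h] }

end SkewMonoidal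

/-! ### The morphism of short multicategories induced by a braided lax monoidal functor. -/

namespace ShortMulticategory

section

variable {C : Type u} [Category.{v} C] [ShortMulticategory C] [LeftRepresentable C]

theorem exists_act_un {b : C} (f : M₀ b) : ∃ q, act₀ q (un C) = f :=
  (un_universal.bijective₀ b).surjective f

theorem exists_post_th {a b c : C} (f : M₂ a b c) : ∃ q, post₂ q (th a b) = f :=
  ((th_universal a b).bijective₂ c).surjective f

theorem exists_post_th₃ {a b c d : C} (f : M₃ a b c d) : ∃ q, post₃ q (th₃ a b c) = f :=
  (bijective_th₃ a b c d).surjective f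

theorem exists_post_th₄ {a b c d e : C} (f : M₄ a b c d e) : ∃ q, post₄ q (th₄ a b c d) = f := by
  obtain ⟨g, rfl⟩ := ((th_universal a b).bijective₄ c d e).surjective f
  obtain ⟨q, rfl⟩ := exists_post_th₃ g
  exact ⟨q, by rw [th₄, post_sub321]⟩

/-- Decompositions of this kind serve as an induction on arity: an equation compatible with
substitution needs checking only on lower multimaps. -/
theorem exists_sub221 {a b c d : C} (f : M₃ a b c d) :
    ∃ (e : C) (g : M₂ e c d) (h : M₂ a b e), sub221 g h = f :=
  ⟨_, _, _, (((th_universal a b).bijective₃ c d).surjective f).choose_spec⟩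

theorem exists_sub321 {a b c d x : C} (f : M₄ a b c d x) :
    ∃ (e : C) (g : M₃ e c d x) (h : M₂ a b e), sub321 g h = f :=
  ⟨_, _, _, (((th_universal a b).bijective₄ c d x).surjective f).choose_spec⟩

theorem exists_sub231 {a b c d x : C} (f : M₄ a b c d x) :
    ∃ (e : C) (g : M₂ e d x) (h : M₃ a b c e), sub231 g h = f := by
  obtain ⟨e, g, h, rfl⟩ := exists_sub321 f
  obtain ⟨e', g, h', rfl⟩ := exists_sub221 g
  exact ⟨_, g, sub221 h' h, assoc2_11 _ _ _⟩

/-- The morphism out of the unit induced by a nullary multimap. -/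
noncomputable def desc₀ {b : C} (f : M₀ b) : unit C ⟶ b := (exists_act_un f).choose

theorem desc₀_act {b : C} (q : unit C ⟶ b) : desc₀ (act₀ q (un C)) = q :=
  (un_universal.bijective₀ b).injective (exists_act_un _).choose_spec

theorem desc₂_post {a b c : C} (q : tens a b ⟶ c) : desc₂ (post₂ q (th a b)) = q :=
  hom_ext₂ (post_desc₂ _)

theorem desc₃_post {a b c d : C} (q : tens (tens a b) c ⟶ d) : desc₃ (post₃ q (th₃ a b c)) = q :=
  hom_ext₃ (post_desc₃ _)

/-- The morphism out of the quadruple tensor product induced by a quaternary multimap. -/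
noncomputable def desc₄ {a b c d e : C} (f : M₄ a b c d e) : tens (tens (tens a b) c) d ⟶ e :=
  (exists_post_th₄ f).choose

theorem desc₄_post {a b c d e : C} (q : tens (tens (tens a b) c) d ⟶ e) :
    desc₄ (post₄ q (th₄ a b c d)) = q :=
  hom_ext₄ (exists_post_th₄ _).choose_spec

end

section

attribute [local instance] skewMonoidal skewBraiding leftNormal

variable {C : Type u₁} [Category.{v₁} C] [ShortMulticategory C] [LeftRepresentable C]
  [ShortBraiding C] {D : Type u₂} [Category.{v₂} D] [ShortMulticategory D] [LeftRepresentable D]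
  [ShortBraiding D] {F : C ⥤ D} (L : SkewMonoidal.LaxBraided F)

/-- The unit comparison of a braided lax monoidal functor. -/
noncomputable def laxUnit : unit D ⟶ F.obj (unit C) := L.f₀

/-- The tensor comparison of a braided lax monoidal functor. -/
noncomputable def laxTens (a b : C) : tens (F.obj a) (F.obj b) ⟶ F.obj (tens a b) := L.f₂ a b

/-- The image of the universal nullary multimap. -/
noncomputable def imUn : M₀ (F.obj (unit C)) := act₀ (laxUnit L) (un D)

/-- The image of a universal binary multimap. -/
noncomputable def imTh (a b : C) : M₂ (F.obj a) (F.obj b) (F.obj (tens a b)) :=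
  post₂ (laxTens L a b) (th (F.obj a) (F.obj b))

/-- The image of a universal ternary multimap. -/
noncomputable def imTh₃ (a b c : C) :
    M₃ (F.obj a) (F.obj b) (F.obj c) (F.obj (tens (tens a b) c)) :=
  sub221 (imTh L (tens a b) c) (imTh L a b)

/-- The image of a universal quaternary multimap. -/
noncomputable def imTh₄ (a b c d : C) :
    M₄ (F.obj a) (F.obj b) (F.obj c) (F.obj d) (F.obj (tens (tens (tens a b) c) d)) :=
  sub231 (imTh L (tens (tens a b) c) d) (imTh₃ L a b c)

/-- Naturality of `f₂`, transferred to the image of `θ`. It is what makes the induced map on binary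
multimaps natural and compatible with `∘₁`. -/
theorem post_imTh {a a' b b' : C} (g : a ⟶ a') (h : b ⟶ b') :
    post₂ (F.map (tensHom g h)) (imTh L a b) =
      act₂ (F.map g) (F.map h) (𝟙 _) (imTh L a' b') := by
  have hn : tensHom (F.map g) (F.map h) ≫ laxTens L a' b' = laxTens L a b ≫ F.map (tensHom g h) :=
    L.f₂_nat g h
  rw [imTh, ← post₂_comp, ← hn, post₂_comp, post_tensHom, imTh, post_act₂, act₂_post]

/-- Displays the threefold comparison map that occurs in both the associativity axiom and the axiom
for `s`, so that these can be applied. -/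
theorem imTh₃_eq (a b c : C) : imTh₃ L a b c =
    post₃ (tensHom (laxTens L a b) (𝟙 (F.obj c)) ≫ laxTens L (tens a b) c)
      (th₃ (F.obj a) (F.obj b) (F.obj c)) := by
  rw [post₃_comp, th₃, post_sub221 (tensHom _ _), post_tensHom, sub221_dinat, post_sub221, imTh₃,
    imTh, imTh]

theorem post_assoc_imTh₃ (a b c : C) : post₃ (F.map (assoc a b c)) (imTh₃ L a b c) =
    sub222 (imTh L a (tens b c)) (imTh L b c) := by
  have h : tensHom (laxTens L a b) (𝟙 (F.obj c)) ≫ laxTens L (tens a b) c ≫ F.map (assoc a b c) =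
    assoc (F.obj a) (F.obj b) (F.obj c) ≫ tensHom (𝟙 (F.obj a)) (laxTens L b c) ≫
      laxTens L a (tens b c) :=
    L.f₂_al a b c
  rw [imTh₃_eq, ← post₃_comp, Category.assoc, h, post₃_comp, post_assoc, post₃_comp,
    post_tensHom_sub222, post_sub222, imTh, imTh]

theorem post_sw_imTh₃ (x a b : C) :
    post₃ (F.map (sw x a b)) (imTh₃ L x a b) = β₃₂ (imTh₃ L x b a) := by
  have h : tensHom (laxTens L x a) (𝟙 (F.obj b)) ≫ laxTens L (tens x a) b ≫ F.map (sw x a b) =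
    sw (F.obj x) (F.obj a) (F.obj b) ≫ tensHom (laxTens L x b) (𝟙 (F.obj a)) ≫
      laxTens L (tens x b) a :=
    L.f₂_s x a b
  rw [imTh₃_eq, ← post₃_comp, Category.assoc, h, post₃_comp, post_sw, post_β₃₂, imTh₃_eq]

/-- The left unit axiom determines the left side only after composition with `F.map (leftUnit a)`.
That map is invertible, with inverse the right side, so the equation follows. For `sub202_imTh` no
inversion is needed, since `ρ` is by definition `θ ∘₂ u`. -/
theorem sub201_imTh (a : C) :
    sub201 (imTh L (unit C) a) (imUn L) = F.map (sub201 (th (unit C) a) (un C)) := by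
  have h : tensHom (laxUnit L) (𝟙 (F.obj a)) ≫ laxTens L (unit C) a ≫ F.map (leftUnit a) =
    leftUnit (F.obj a) := L.f₂_lam a
  have h' : sub201 (imTh L (unit C) a) (imUn L) ≫ F.map (leftUnit a) = 𝟙 _ := by
    rw [← th_leftUnit (F.obj a), ← h, ← Category.assoc, sub201_comp (th _ _), post_tensHom,
      sub201_dinat, ← Category.assoc, sub201_comp (th _ _), imTh, imUn]
  have h'' : F.map (leftUnit a) ≫ F.map (sub201 (th (unit C) a) (un C)) = 𝟙 _ := by
    rw [← F.map_comp, leftUnit_th, F.map_id]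
  rw [← Category.comp_id (sub201 (imTh L (unit C) a) (imUn L)), ← h'', reassoc_of% h']

theorem sub202_imTh (a : C) :
    sub202 (imTh L a (unit C)) (imUn L) = F.map (sub202 (th a (unit C)) (un C)) := by
  have h : rightUnit (F.obj a) ≫ tensHom (𝟙 (F.obj a)) (laxUnit L) ≫ laxTens L a (unit C) =
    F.map (rightUnit a) := L.f₂_rh a
  rw [← rightUnit, ← h, rightUnit, ← Category.assoc, sub202_comp, post_tensHom, sub202_dinat,
    sub202_comp, imTh, imUn]

/-- The action of a braided lax monoidal functor on nullary multimaps. -/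
noncomputable def mapOfLax₀ {b : C} (f : M₀ b) : M₀ (F.obj b) := act₀ (F.map (desc₀ f)) (imUn L)

/-- The action of a braided lax monoidal functor on binary multimaps. -/
noncomputable def mapOfLax₂ {a b c : C} (f : M₂ a b c) : M₂ (F.obj a) (F.obj b) (F.obj c) :=
  post₂ (F.map (desc₂ f)) (imTh L a b)

/-- The action of a braided lax monoidal functor on ternary multimaps. -/
noncomputable def mapOfLax₃ {a b c d : C} (f : M₃ a b c d) :
    M₃ (F.obj a) (F.obj b) (F.obj c) (F.obj d) :=
  post₃ (F.map (desc₃ f)) (imTh₃ L a b c)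

/-- The action of a braided lax monoidal functor on quaternary multimaps. -/
noncomputable def mapOfLax₄ {a b c d e : C} (f : M₄ a b c d e) :
    M₄ (F.obj a) (F.obj b) (F.obj c) (F.obj d) (F.obj e) :=
  post₄ (F.map (desc₄ f)) (imTh₄ L a b c d)

theorem mapOfLax₀_act_un {b : C} (q : unit C ⟶ b) :
    mapOfLax₀ L (act₀ q (un C)) = act₀ (F.map q) (imUn L) := by
  rw [mapOfLax₀, desc₀_act]

theorem mapOfLax₂_post_th {a b c : C} (q : tens a b ⟶ c) :
    mapOfLax₂ L (post₂ q (th a b)) = post₂ (F.map q) (imTh L a b) := by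
  rw [mapOfLax₂, desc₂_post]

theorem mapOfLax₃_post_th₃ {a b c d : C} (q : tens (tens a b) c ⟶ d) :
    mapOfLax₃ L (post₃ q (th₃ a b c)) = post₃ (F.map q) (imTh₃ L a b c) := by
  rw [mapOfLax₃, desc₃_post]

theorem mapOfLax₄_post_th₄ {a b c d e : C} (q : tens (tens (tens a b) c) d ⟶ e) :
    mapOfLax₄ L (post₄ q (th₄ a b c d)) = post₄ (F.map q) (imTh₄ L a b c d) := by
  rw [mapOfLax₄, desc₄_post]

theorem mapOfLax₀_act {b b' : C} (q : b ⟶ b') (f : M₀ b) :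
    mapOfLax₀ L (act₀ q f) = act₀ (F.map q) (mapOfLax₀ L f) := by
  obtain ⟨p, rfl⟩ := exists_act_un f
  rw [act₀_comp, mapOfLax₀_act_un, mapOfLax₀_act_un, act₀_comp, F.map_comp]

theorem mapOfLax₂_act {a₁ a₁' a₂ a₂' b b' : C} (p₁ : a₁' ⟶ a₁) (p₂ : a₂' ⟶ a₂) (q : b ⟶ b')
    (f : M₂ a₁ a₂ b) : mapOfLax₂ L (act₂ p₁ p₂ q f) =
      act₂ (F.map p₁) (F.map p₂) (F.map q) (mapOfLax₂ L f) := by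
  obtain ⟨r, rfl⟩ := exists_post_th f
  -- Precomposition in the inputs is absorbed into a unary map after the universal multimap, the
  -- only form on which `mapOfLax₂` is given explicitly.
  have h : act₂ p₁ p₂ q (post₂ r (th a₁ a₂)) =
      post₂ (tensHom p₁ p₂ ≫ r ≫ q) (th a₁' a₂') := by
    rw [post₂_comp, post_tensHom, post_act₂, ← act₂_post, ← post₂_comp, act₂_post]
  rw [h, mapOfLax₂_post_th, mapOfLax₂_post_th, F.map_comp, post₂_comp, post_imTh, post_act₂,
    ← act₂_post _ _ (F.map q), ← post₂_comp, ← F.map_comp, act₂_post]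

/-- Every binary multimap is `p ∘ θ`, so `∘₁` becomes a unary map after `θ ∘₁ θ`, and naturality of
`f₂` suffices. -/
theorem mapOfLax₃_sub221 {a₁ a₂ b₁ b₂ c : C} (g : M₂ b₁ b₂ c) (f : M₂ a₁ a₂ b₁) :
    mapOfLax₃ L (sub221 g f) = sub221 (mapOfLax₂ L g) (mapOfLax₂ L f) := by
  obtain ⟨p, rfl⟩ := exists_post_th g
  obtain ⟨q, rfl⟩ := exists_post_th f
  rw [← post_sub221, ← post_tensHom_sub221, ← th₃, ← post₃_comp, mapOfLax₃_post_th₃,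
    mapOfLax₂_post_th, mapOfLax₂_post_th, F.map_comp, post₃_comp, imTh₃, post_sub221, post_imTh,
    F.map_id, sub221_dinat, post_sub221]

/-- Here `θ ∘₂ θ` must first be rewritten as the associator after `θ ∘₁ θ`; this is the use of the
associativity axiom of the lax structure. -/
theorem mapOfLax₃_sub222 {a₁ a₂ b₁ b₂ c : C} (g : M₂ b₁ b₂ c) (f : M₂ a₁ a₂ b₂) :
    mapOfLax₃ L (sub222 g f) = sub222 (mapOfLax₂ L g) (mapOfLax₂ L f) := by
  obtain ⟨p, rfl⟩ := exists_post_th g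
  obtain ⟨q, rfl⟩ := exists_post_th f
  rw [← post_sub222, ← post_tensHom_sub222, ← post_assoc, ← post₃_comp, ← post₃_comp,
    mapOfLax₃_post_th₃, mapOfLax₂_post_th, mapOfLax₂_post_th, F.map_comp, F.map_comp, post₃_comp,
    post₃_comp, post_assoc_imTh₃, post_sub222, post_imTh, F.map_id, sub222_dinat, post_sub222]

theorem mapOfLax₄_sub231 {a₁ a₂ a₃ b₁ b₂ c : C} (g : M₂ b₁ b₂ c) (f : M₃ a₁ a₂ a₃ b₁) :
    mapOfLax₄ L (sub231 g f) = sub231 (mapOfLax₂ L g) (mapOfLax₃ L f) := by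
  obtain ⟨p, rfl⟩ := exists_post_th g
  obtain ⟨q, rfl⟩ := exists_post_th₃ f
  rw [← post_sub231, ← post_tensHom_sub231, ← th₄_eq, ← post₄_comp, mapOfLax₄_post_th₄,
    mapOfLax₂_post_th, mapOfLax₃_post_th₃, F.map_comp, post₄_comp, imTh₄, post_sub231, post_imTh,
    F.map_id, sub231_dinat, post_sub231]

/-- No further axiom of the lax functor is needed. Writing the ternary map as a substitution of
binary ones, associativity reduces the claim to `∘₁` with a ternary map. The three lemmas that
follow reduce in the same way to cases already settled. -/
theorem mapOfLax₄_sub321 {a₁ a₂ b₁ b₂ b₃ c : C} (g : M₃ b₁ b₂ b₃ c) (f : M₂ a₁ a₂ b₁) :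
    mapOfLax₄ L (sub321 g f) = sub321 (mapOfLax₃ L g) (mapOfLax₂ L f) := by
  obtain ⟨_, g, h, rfl⟩ := exists_sub221 g
  rw [← assoc2_11, mapOfLax₄_sub231, mapOfLax₃_sub221, mapOfLax₃_sub221, assoc2_11]

theorem mapOfLax₄_sub322 {a₁ a₂ b₁ b₂ b₃ c : C} (g : M₃ b₁ b₂ b₃ c) (f : M₂ a₁ a₂ b₂) :
    mapOfLax₄ L (sub322 g f) = sub322 (mapOfLax₃ L g) (mapOfLax₂ L f) := by
  obtain ⟨_, g, h, rfl⟩ := exists_sub221 g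
  rw [← assoc2_12, mapOfLax₄_sub231, mapOfLax₃_sub222, mapOfLax₃_sub221, assoc2_12]

theorem mapOfLax₄_sub323 {a₁ a₂ b₁ b₂ b₃ c : C} (g : M₃ b₁ b₂ b₃ c) (f : M₂ a₁ a₂ b₃) :
    mapOfLax₄ L (sub323 g f) = sub323 (mapOfLax₃ L g) (mapOfLax₂ L f) := by
  obtain ⟨_, g, h, rfl⟩ := exists_sub221 g
  rw [comm_22, mapOfLax₄_sub321, mapOfLax₃_sub222, mapOfLax₃_sub221, comm_22]

theorem mapOfLax₄_sub232 {a₁ a₂ a₃ b₁ b₂ c : C} (g : M₂ b₁ b₂ c) (f : M₃ a₁ a₂ a₃ b₂) :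
    mapOfLax₄ L (sub232 g f) = sub232 (mapOfLax₂ L g) (mapOfLax₃ L f) := by
  obtain ⟨_, f, h, rfl⟩ := exists_sub221 f
  rw [assoc2_21, mapOfLax₄_sub322, mapOfLax₃_sub222, mapOfLax₃_sub221, assoc2_21]

theorem map_sub201_of_lax {b₁ b₂ c : C} (g : M₂ b₁ b₂ c) (f : M₀ b₁) :
    F.map (sub201 g f) = sub201 (mapOfLax₂ L g) (mapOfLax₀ L f) := by
  obtain ⟨p, rfl⟩ := exists_act_un f
  -- Dinaturality moves the unary map `p` into `g`, leaving the universal nullary multimap on both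
  -- sides. Identities are written as images under `F` so that `mapOfLax₂_act` applies.
  rw [← sub201_dinat, mapOfLax₀_act_un, ← sub201_dinat, ← F.map_id, ← F.map_id, ← mapOfLax₂_act]
  obtain ⟨q, hq⟩ := exists_post_th (act₂ p (𝟙 b₂) (𝟙 c) g)
  rw [← hq, mapOfLax₂_post_th, ← sub201_comp, ← sub201_comp, sub201_imTh, F.map_comp]

theorem map_sub202_of_lax {b₁ b₂ c : C} (g : M₂ b₁ b₂ c) (f : M₀ b₂) :
    F.map (sub202 g f) = sub202 (mapOfLax₂ L g) (mapOfLax₀ L f) := by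
  obtain ⟨p, rfl⟩ := exists_act_un f
  rw [← sub202_dinat, mapOfLax₀_act_un, ← sub202_dinat, ← F.map_id, ← F.map_id, ← mapOfLax₂_act]
  obtain ⟨q, hq⟩ := exists_post_th (act₂ (𝟙 b₁) p (𝟙 c) g)
  rw [← hq, mapOfLax₂_post_th, ← sub202_comp, ← sub202_comp, sub202_imTh, F.map_comp]

/-- The morphism of short multicategories associated with a braided lax monoidal functor. -/
@[reducible] noncomputable def multifunctorOfLax : ShortMultifunctor C D where
  toFunctor := F
  map₀ := mapOfLax₀ L
  map₂ := mapOfLax₂ L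
  map₃ := mapOfLax₃ L
  map₄ := mapOfLax₄ L
  map₀_act := mapOfLax₀_act L
  map₂_act := mapOfLax₂_act L
  map₃_act p₁ p₂ p₃ q f := by
    obtain ⟨_, g, h, rfl⟩ := exists_sub221 f
    rw [sub221_nat, mapOfLax₃_sub221, mapOfLax₂_act, mapOfLax₂_act, mapOfLax₃_sub221, sub221_nat,
      F.map_id]
  map₄_act p₁ p₂ p₃ p₄ q f := by
    obtain ⟨_, f, h, rfl⟩ := exists_sub321 f
    obtain ⟨_, f, g, rfl⟩ := exists_sub221 f
    rw [sub321_nat, sub221_nat, mapOfLax₄_sub321, mapOfLax₃_sub221, mapOfLax₂_act, mapOfLax₂_act,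
      mapOfLax₂_act, mapOfLax₄_sub321, mapOfLax₃_sub221, sub321_nat, sub221_nat, F.map_id, F.map_id]
  map_sub221 := mapOfLax₃_sub221 L
  map_sub222 := mapOfLax₃_sub222 L
  map_sub321 := mapOfLax₄_sub321 L
  map_sub322 := mapOfLax₄_sub322 L
  map_sub323 := mapOfLax₄_sub323 L
  map_sub231 := mapOfLax₄_sub231 L
  map_sub232 := mapOfLax₄_sub232 L
  map_sub201 := map_sub201_of_lax L
  map_sub202 := map_sub202_of_lax L
  map_sub301 g f := by
    obtain ⟨_, g, h, rfl⟩ := exists_sub221 g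
    rw [← assoc0_11, mapOfLax₂_act, map_sub201_of_lax L, mapOfLax₃_sub221, F.map_id, F.map_id,
      assoc0_11]
  map_sub302 g f := by
    obtain ⟨_, g, h, rfl⟩ := exists_sub221 g
    rw [← assoc0_12, mapOfLax₂_act, map_sub202_of_lax L, mapOfLax₃_sub221, F.map_id, F.map_id,
      assoc0_12]
  -- The third input lies outside the inner binary map `h`, so the interchange law `comm_20`
  -- replaces associativity.
  map_sub303 g f := by
    obtain ⟨_, g, h, rfl⟩ := exists_sub221 g
    rw [comm_20, mapOfLax₂_act, map_sub202_of_lax L, mapOfLax₃_sub221, F.map_id, F.map_id,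
      comm_20]

/-- By naturality of `β₃₂` it is enough to treat the universal ternary multimap, where `β₃₂` is
postcomposition with `s`; compatibility of the lax structure with `s` does the rest. -/
theorem mapOfLax₃_β₃₂ {a₁ a₂ a₃ b : C} (f : M₃ a₁ a₂ a₃ b) :
    mapOfLax₃ L (β₃₂ f) = β₃₂ (mapOfLax₃ L f) := by
  obtain ⟨q, rfl⟩ := exists_post_th₃ f
  rw [← post_β₃₂, ← post_sw, ← post₃_comp, mapOfLax₃_post_th₃, mapOfLax₃_post_th₃, F.map_comp,
    post₃_comp, post_sw_imTh₃, post_β₃₂]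

theorem isBraided_multifunctorOfLax : (multifunctorOfLax L).IsBraided where
  map_β₃₂ := mapOfLax₃_β₃₂ L
  -- `β₄₂` interchanges inputs two and three, which lie inside the ternary part of a decomposition
  -- by `sub231`, where it acts as `β₃₂`.
  map_β₄₂ f := by
    obtain ⟨_, g, h, rfl⟩ := exists_sub231 f
    change mapOfLax₄ L _ = β₄₂ (mapOfLax₄ L _)
    rw [← sub231_β₃₂, mapOfLax₄_sub231, mapOfLax₃_β₃₂, sub231_β₃₂, mapOfLax₄_sub231]
  -- `β₄₃` interchanges the last two inputs, which belong to the outer ternary map of a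
  -- decomposition by `sub321`.
  map_β₄₃ f := by
    obtain ⟨_, g, h, rfl⟩ := exists_sub321 f
    change mapOfLax₄ L _ = β₄₃ (mapOfLax₄ L _)
    rw [β₄₃_sub321, mapOfLax₄_sub321, mapOfLax₃_β₃₂, mapOfLax₄_sub321, β₄₃_sub321]

/-- With `comparison₂_multifunctorOfLax`, this recovers the lax structure from the multifunctor
built from it, which gives fullness of `K`. -/
theorem comparison₀_multifunctorOfLax : comparison₀ (multifunctorOfLax L) = laxUnit L :=
  (un_universal.bijective₀ _).injective (by
    change act₀ (comparison₀ (multifunctorOfLax L)) (un D) = imUn L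
    rw [act_comparison₀]
    change mapOfLax₀ L (un C) = _
    rw [← act₀_id (un C), mapOfLax₀_act_un, F.map_id, act₀_id])

theorem comparison₂_multifunctorOfLax (a b : C) :
    comparison₂ (multifunctorOfLax L) a b = laxTens L a b :=
  hom_ext₂ (by
    rw [post_comparison₂]
    change mapOfLax₂ L (th a b) = imTh L a b
    rw [← act₂_id (th a b), mapOfLax₂_post_th, F.map_id, post₂, act₂_id])

/-- The two morphisms agree on `u` and `θ`, hence on nullary and binary multimaps; those of arity
three and four are substitutions of lower ones. This gives faithfulness of `K`. -/
theorem multifunctorOfLax_laxBraided (G : ShortMultifunctor C D) (hG : G.IsBraided) :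
    multifunctorOfLax (laxBraided G hG) = G := by
  have h₀ : imUn (laxBraided G hG) = G.map₀ (un C) := act_comparison₀ G
  have h₂ (a b : C) : imTh (laxBraided G hG) a b = G.map₂ (th a b) := post_comparison₂ G a b
  have e₀ {b : C} (f : M₀ b) : mapOfLax₀ (laxBraided G hG) f = G.map₀ f := by
    obtain ⟨q, rfl⟩ := exists_act_un f
    rw [mapOfLax₀_act_un, h₀, G.map₀_act]
  have e₂ {a b c : C} (f : M₂ a b c) : mapOfLax₂ (laxBraided G hG) f = G.map₂ f := by
    obtain ⟨q, rfl⟩ := exists_post_th f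
    rw [mapOfLax₂_post_th, h₂, map_post₂]
  have e₃ {a b c d : C} (f : M₃ a b c d) : mapOfLax₃ (laxBraided G hG) f = G.map₃ f := by
    obtain ⟨_, g, h, rfl⟩ := exists_sub221 f
    rw [mapOfLax₃_sub221, e₂, e₂, G.map_sub221]
  have e₄ {a b c d e : C} (f : M₄ a b c d e) : mapOfLax₄ (laxBraided G hG) f = G.map₄ f := by
    obtain ⟨_, g, h, rfl⟩ := exists_sub321 f
    rw [mapOfLax₄_sub321, e₂, e₃, G.map_sub321]
  obtain ⟨G, _⟩ := G
  unfold multifunctorOfLax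
  congr 1 <;> ext <;> apply_assumption

end

end ShortMulticategory

/-! ### Full faithfulness, essential surjectivity and the two equivalences. -/

section

variable {C : Type u} [Category.{v} C] [ShortMulticategory C] [ShortBraiding C]
  [LeftRepresentable C] {D : Type u} [Category.{v} D] [ShortMulticategory D] [ShortBraiding D]
  [LeftRepresentable D]

attribute [local instance] skewMonoidal skewBraiding leftNormal

/-- The functor underlying a morphism between values of `K`. -/
@[reducible] noncomputable def functorOfHom (G : kBrdObj C ⟶ kBrdObj D) : C ⥤ D := G.toFunctor

/-- The braided lax monoidal structure, with respect to the braided skew monoidal structures,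
underlying a morphism between values of `K`. -/
@[reducible] noncomputable def laxOfHom (G : kBrdObj C ⟶ kBrdObj D) :
    SkewMonoidal.LaxBraided (functorOfHom G) :=
  SkewMonoidal.LaxBraided.ofFunctorLaxBraided (functorOfHom G) G.laxBraided

/-- The braided morphism of short multicategories associated with a morphism between values of
`K`. -/
noncomputable def kBrdPreimage (G : kBrdObj C ⟶ kBrdObj D) : ShortMultifunctor C D :=
  multifunctorOfLax (laxOfHom G)

theorem isBraided_kBrdPreimage (G : kBrdObj C ⟶ kBrdObj D) : (kBrdPreimage G).IsBraided :=
  isBraided_multifunctorOfLax (laxOfHom G)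

theorem kBrdMap_kBrdPreimage (G : kBrdObj C ⟶ kBrdObj D) :
    kBrdMap (kBrdPreimage G) (isBraided_kBrdPreimage G) = G :=
  (BrdMonCat.laxBraidedFunctor_eq G _
    (kBrdMap (kBrdPreimage G) (isBraided_kBrdPreimage G)).laxBraided rfl
    (comparison₀_multifunctorOfLax (C := C) (D := D) (laxOfHom G)).symm
    (fun a b ↦ (comparison₂_multifunctorOfLax (C := C) (D := D) (laxOfHom G) a b).symm)).symm

theorem kBrdPreimage_kBrdMap (F : ShortMultifunctor C D) (hF : F.IsBraided) :
    kBrdPreimage (kBrdMap F hF) = F :=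
  -- Passing from the skew lax structure to the monoidal one and back leaves `f₀` and `f₂`
  -- untouched, so the two structures agree definitionally.
  multifunctorOfLax_laxBraided F hF

end

/-- The functor `K` is fully faithful. -/
noncomputable def fullyFaithfulKBrd : kBrd.{v, u}.FullyFaithful where
  preimage {X Y} G :=
    haveI := X.property
    haveI := Y.property
    ⟨⟨kBrdPreimage G, isBraided_kBrdPreimage G⟩⟩
  map_preimage {X Y} G :=
    haveI := X.property
    haveI := Y.property
    kBrdMap_kBrdPreimage G
  preimage_map {X Y} F :=
    haveI := X.property
    haveI := Y.property
    ObjectProperty.hom_ext _ (Subtype.ext (kBrdPreimage_kBrdMap F.hom.1 F.hom.2))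

/-- The left representable braided short multicategory of a braided monoidal category. -/
def brdShortMulticatOfBrdMon (V : BrdMonCat.{v, u}) : BrdShortMulticatLR.{v, u} where
  obj :=
    letI := shortMulticategoryOfMonoidal V.carrier
    letI := shortBraidingOfBraided V.carrier
    ⟨V.carrier⟩
  property := leftRepresentable_shortMulticategoryOfMonoidal V.carrier

/-- `K` of the short multicategory of `V` is isomorphic to `V`. -/
noncomputable def kBrdObjIso (V : BrdMonCat.{v, u}) :
    kBrd.obj (brdShortMulticatOfBrdMon V) ≅ V :=
  MonoidalMultimaps.comparisonIso V.carrier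

theorem isEquivalence_kBrd : kBrd.{v, u}.IsEquivalence where
  faithful := fullyFaithfulKBrd.faithful
  full := fullyFaithfulKBrd.full
  essSurj := ⟨fun V ↦ ⟨_, ⟨kBrdObjIso V⟩⟩⟩

/-- Full faithfulness restricts to full subcategories. For essential surjectivity the same preimage
serves, because `swapLast` is involutive when the braiding is a symmetry. -/
theorem isEquivalence_kSym : kSym.{v, u}.IsEquivalence :=
  have := isEquivalence_kBrd.{v, u}
  { faithful := inferInstanceAs (ObjectProperty.lift _ _ _).Faithful
    full := inferInstanceAs (ObjectProperty.lift _ _ _).Full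
    essSurj := ⟨fun V ↦ ⟨⟨brdShortMulticatOfBrdMon V.obj,
      isShortSymmetry_shortBraidingOfBraided V.property⟩,
      ⟨ObjectProperty.isoMk _ (kBrdObjIso V.obj)⟩⟩⟩ }

theorem mainTheorem9 :
    kBrd.{v, u}.IsEquivalence ∧ kSym.{v, u}.IsEquivalence :=
  ⟨isEquivalence_kBrd, isEquivalence_kSym⟩
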